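/- Let $M$ be a smooth surface with a smooth projective structure $[\nabla]$ (a projective equivalence class of torsion-free affine connections, where $\hat\nabla\sim\nabla$ iff $\hat\nabla_aX^b=\nabla_aX^b+\Upsilon_aX^b+\delta_a{}^b\Upsilon_cX^c$ for some smooth 1-form $\Upsilon$). Fix a smooth nowhere vanishing 2-form $\epsilon_{ab}$ on $M$ and $\nabla\in[\nabla]$ with $\nabla_a\epsilon_{bc}=0$. Let $\epsilon^{ab}$ be the skew bivector with $\epsilon^{ac}\epsilon_{bc}=\delta^a{}_b$. The curvature is given by $(\nabla_a\nabla_b-\nabla_b\nabla_a)X^c=R_{ab}{}^c{}_dX^d$. Put $R_{ab}=R_{ca}{}^c{}_b$, $\mathrm P_{ab}=\tfrac23R_{ab}+\tfrac13R_{ba}$, $Y_{abc}=\nabla_a\mathrm P_{bc}-\nabla_b\mathrm P_{ac}$, $Y_a=\epsilon^{bc}Y_{bca}$, $Y^a=\epsilon^{ab}Y_b$, and $$\phi=2\nabla_aY^a,\qquad W^a=Y^b\nabla_bY^a-\tfrac{2\phi}{3}Y^a,\qquad W_b=W^a\epsilon_{ab},\qquad \rho=Y_aW^a,\qquad \ell=\tfrac{5\phi^2}{12}+3\mathrm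 P_{ab}Y^aY^b-\tfrac12Y^a\nabla_a\phi .$$ Suppose that $\rho$ vanishes nowhere on $M$. At each point of $M$ define the polynomials $$P_1(t)=-90t^6+a_1t^4+a_2t^2-9\rho t+a_3,\quad P_2(t)=-275t^8+b_1t^4+20\rho t^3+b_2t^2+b_3,\quad P_3(t)=-40t^6+c_1t^4+c_2t^2+\rho t+c_3,$$ of degrees $6$, $8$ and $6$, where \begin{align*} a_1&=15\Big(\tfrac{Y^a\nabla_a\rho}{\rho}-\tfrac{5\phi}{2}\Big),\qquad a_2=-\Big(\tfrac{3W^a\nabla_a\rho}{\rho}+6\ell-3\nabla_aW^a\Big),\\ a_3&=\tfrac12W^a\nabla_a\phi+\tfrac{\phi}{2}\nabla_aW^a+Y^a\nabla_a\ell+\tfrac{\phi\ell}{2}-\tfrac{\phi W^a\nabla_a\rho}{2\rho}-\ell\tfrac{Y^a\nabla_a\rho}{\rho},\\ b_1&=-\tfrac{5W^eY^d\nabla_eW_d}{\rho}+\tfrac{50\ell}{3},\qquad b_2=\tfrac{W^eW^a\nabla_eW_a}{\rho},\\ b_3&=\tfrac{\phi W^eW^a\nabla_eW_a}{6\rho}+\mathrm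 P_{ea}W^eW^a+\tfrac{\ell^2}{9}+\tfrac{\ell W^eY^d\nabla_eW_d}{3\rho}+\tfrac13W^e\nabla_e\ell,\\ c_1&=-\tfrac{5Y^a(W^e\nabla_eY_a+Y^e\nabla_aW_e)}{2\rho}-\tfrac{25\phi}{6},\qquad c_2=\tfrac{2\ell}{3}+\tfrac{W^e(W^d\nabla_eY_d+Y^d\nabla_dW_e)}{2\rho},\\ c_3&=-\tfrac{W^e\nabla_e\phi}{12}+\tfrac{\phi W^bW^e\nabla_eY_b}{12\rho}+\tfrac{\ell W^eY^a\nabla_eY_a}{6\rho}+\mathrm P_{ae}W^eY^a+\tfrac{Y^e\nabla_e\ell}{6}+\tfrac{\phi W^eY^a\nabla_aW_e}{12\rho}-\tfrac{\ell\phi}{18}+\tfrac{\ell Y^bY^a\nabla_aW_b}{6\rho}. \end{align*} Then: (i) The coefficients of $P_1,P_2,P_3$ are (weighted) projective invariants: if $\hat\nabla\in[\nabla]$ and $\hat\epsilon=r\,\epsilon$ is a volume form with $\hat\nabla\hat\epsilon=0$, then the coefficients $\hat p_{i,k}$ of $t^k$ in $\hat P_i$, computed from $(\hat\nabla,\hat\epsilon)$,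 and $p_{i,k}$ of $t^k$ in $P_i$ satisfy $r^{d_i}\hat p_{i,k}=r^{k}p_{i,k}$, where $(d_1,d_2,d_3)=(6,8,6)$. (ii) If a smooth 1-form $\alpha_a$ on $M$ solves the projective Einstein--Weyl equation $\nabla_{(a}\alpha_{b)}+\alpha_a\alpha_b+\mathrm P_{(ab)}=0$, then the function $F=\epsilon^{ab}\nabla_{[a}\alpha_{b]}$ satisfies $P_1(F)=P_2(F)=P_3(F)=0$ at every point of $M$. -/

import Mathlib

open Bundle FiberBundle
open scoped Manifold ContDiff

noncomputable section

/-! Projective differential geometry on smooth surfaces (manifolds modelled on `ℝ²`).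

Tensor fields are written through their values on tangent vectors: `θ x u` is `θ_a u^a` at `x`,
and `T x u v` is `T_{ab} u^a v^b` at `x`. -/

namespace ProjSurface

variable (M : Type*) [TopologicalSpace M] [ChartedSpace (EuclideanSpace ℝ (Fin 2)) M]

/-- Vector fields `X^a` (no regularity). -/
abbrev VectorField : Type _ := ∀ x : M, TangentSpace (𝓡 2) x

/-- One-forms `α_a` (no regularity). -/
abbrev OneForm : Type _ := ∀ x : M, TangentSpace (𝓡 2) x →L[ℝ] ℝ

variable [IsManifold (𝓡 2) ∞ M]

/-- Affine connections, that is, covariant derivatives on the tangent bundle.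
The vector `∇_u X` at `x`, that is `u^a ∇_a X^b`, is `D X x u`. -/
abbrev AffineConnection : Type _ :=
  CovariantDerivative (𝓡 2) (EuclideanSpace ℝ (Fin 2)) (TangentSpace (𝓡 2) : M → Type _)

variable {M}

/-- A smooth one-form: a smooth section of the cotangent bundle. -/
def OneForm.IsSmooth (α : OneForm M) : Prop :=
  ContMDiff (𝓡 2) ((𝓡 2).prod 𝓘(ℝ, EuclideanSpace ℝ (Fin 2) →L[ℝ] ℝ)) ∞
    (fun x : M ↦ TotalSpace.mk' (EuclideanSpace ℝ (Fin 2) →L[ℝ] ℝ)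
      (E := fun x : M ↦ TangentSpace (𝓡 2) x →L[ℝ] ℝ) x (α x))

/-- A smooth torsion-free affine connection. -/
def IsSmoothTorsionFree (D : AffineConnection M) : Prop :=
  CovariantDerivative.ContMDiffCovariantDerivative D ∞ ∧ D.torsion = 0

/-- Projective equivalence of affine connections:
`∇'_a X^b = ∇_a X^b + Υ_a X^b + δ_a^b Υ_c X^c` for some smooth one-form `Υ`. Dually, on one-forms,
`∇'_a θ_b = ∇_a θ_b - Υ_a θ_b - Υ_b θ_a`. -/
def ProjEquiv (D D' : AffineConnection M) : Prop :=
  ∃ Υ : OneForm M, Υ.IsSmooth ∧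
    ∀ (X : VectorField M) (x : M),
      MDifferentiableAt (𝓡 2) ((𝓡 2).prod 𝓘(ℝ, EuclideanSpace ℝ (Fin 2)))
        (fun y ↦ TotalSpace.mk' (EuclideanSpace ℝ (Fin 2))
          (E := (TangentSpace (𝓡 2) : M → Type _)) y (X y)) x →
      ∀ u : TangentSpace (𝓡 2) x,
        D' X x u = D X x u + Υ x u • X x + Υ x (X x) • u

variable (M) in
/-- A projective structure: a projective equivalence class of smooth torsion-free affine
connections. -/
structure ProjectiveStructure where
  /-- The connections in the class. -/
  conns : Set (AffineConnection M)
  nonempty : conns.Nonempty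
  mem_iff : ∀ D ∈ conns, ∀ D' : AffineConnection M,
    D' ∈ conns ↔ IsSmoothTorsionFree D' ∧ ProjEquiv D D'

/-- The standard basis of the tangent space at `x`. It is used only to write down traces and
contractions, which do not depend on the basis. -/
def tangentBasis (x : M) : Module.Basis (Fin 2) ℝ (TangentSpace (𝓡 2) x) :=
  (EuclideanSpace.basisFun (Fin 2) ℝ).toBasis

/-- The trace `A_a{}^a` of `u ↦ A u`. -/
def trace (x : M) (A : TangentSpace (𝓡 2) x → TangentSpace (𝓡 2) x) : ℝ :=
  ∑ i, (tangentBasis x).repr (A (tangentBasis x i)) i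

/-- The derivative `X^a ∇_a f` of a function along a vector field. -/
def along (X : VectorField M) (f : M → ℝ) (x : M) : ℝ := mvfderiv (𝓡 2) f x (X x)

/-- The divergence `∇_a X^a`. -/
def divergence (D : AffineConnection M) (X : VectorField M) (x : M) : ℝ :=
  trace x (fun u ↦ D X x u)

/-- The covariant derivative `u^a v^b ∇_a θ_b` of a one-form:
`(∇_u θ)(v) = u(θ(V)) - θ(∇_u V)`, where the vector field `V` extends `v`. -/
def covOneForm (D : AffineConnection M) (θ : ∀ x : M, TangentSpace (𝓡 2) x → ℝ) (x : M)
    (u v : TangentSpace (𝓡 2) x) : ℝ :=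
  mvfderiv (𝓡 2) (fun y ↦ θ y (extend (EuclideanSpace ℝ (Fin 2)) v y)) x u
    - θ x (D (extend (EuclideanSpace ℝ (Fin 2)) v) x u)

/-- The covariant derivative `u^a v^b w^c ∇_a T_{bc}` of a covariant two-tensor:
`(∇_u T)(v, w) = u(T(V, W)) - T(∇_u V, w) - T(v, ∇_u W)`, where `V` and `W` extend `v` and `w`. -/
def covBilin (D : AffineConnection M)
    (T : ∀ x : M, TangentSpace (𝓡 2) x → TangentSpace (𝓡 2) x → ℝ) (x : M)
    (u v w : TangentSpace (𝓡 2) x) : ℝ :=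
  mvfderiv (𝓡 2) (fun y ↦ T y (extend (EuclideanSpace ℝ (Fin 2)) v y)
      (extend (EuclideanSpace ℝ (Fin 2)) w y)) x u
    - T x (D (extend (EuclideanSpace ℝ (Fin 2)) v) x u) w
    - T x v (D (extend (EuclideanSpace ℝ (Fin 2)) w) x u)

/-- `∇_U ∇_V Z - ∇_V ∇_U Z - ∇_[U,V] Z` for vector fields. -/
def curvatureField (D : AffineConnection M) (U V Z : VectorField M) (x : M) :
    TangentSpace (𝓡 2) x :=
  D (fun y ↦ D Z y (V y)) x (U x) - D (fun y ↦ D Z y (U y)) x (V x)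
    - D Z x (VectorField.mlieBracket (𝓡 2) U V x)

/-- The curvature tensor `R_{ab}{}^c{}_d u^a v^b z^d`. -/
def curvature (D : AffineConnection M) (x : M) (u v z : TangentSpace (𝓡 2) x) :
    TangentSpace (𝓡 2) x :=
  curvatureField D (extend (EuclideanSpace ℝ (Fin 2)) u) (extend (EuclideanSpace ℝ (Fin 2)) v)
    (extend (EuclideanSpace ℝ (Fin 2)) z) x

/-- The Ricci tensor `R_{ab} = R_{ca}{}^c{}_b`. -/
def ricci (D : AffineConnection M) (x : M) (v w : TangentSpace (𝓡 2) x) : ℝ :=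
  trace x (fun u ↦ curvature D x u v w)

/-- The projective rho tensor `P_{ab} = (n R_{ab} + R_{ba}) / (n² - 1)` in dimension `n = 2`. -/
def schouten (D : AffineConnection M) (x : M) (v w : TangentSpace (𝓡 2) x) : ℝ :=
  2 / 3 * ricci D x v w + 1 / 3 * ricci D x w v

/-- The Cotton-York tensor `Y_{abc} = ∇_a P_{bc} - ∇_b P_{ac}`. -/
def cotton (D : AffineConnection M) (x : M) (u v w : TangentSpace (𝓡 2) x) : ℝ :=
  covBilin D (schouten D) x u v w - covBilin D (schouten D) x v u w

/-- The projective Einstein-Weyl equation `∇_{(a} α_{b)} + α_a α_b + P_{(ab)} = 0`. -/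
def IsPEWSolution (D : AffineConnection M) (α : OneForm M) : Prop :=
  ∀ (x : M) (u v : TangentSpace (𝓡 2) x),
    (covOneForm D (fun y ↦ α y) x u v + covOneForm D (fun y ↦ α y) x v u) / 2
      + α x u * α x v + (schouten D x u v + schouten D x v u) / 2 = 0

variable (M) in
/-- A smooth volume form `ε_{ab}`: a smooth, nowhere vanishing two-form. -/
structure VolumeForm where
  /-- The underlying field of bilinear forms. -/
  form : ∀ x : M, TangentSpace (𝓡 2) x →L[ℝ] TangentSpace (𝓡 2) x →L[ℝ] ℝ
  alternating : ∀ (x : M) (v : TangentSpace (𝓡 2) x), form x v v = 0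
  ne_zero : ∀ x : M, form x ≠ 0
  smooth : ContMDiff (𝓡 2)
    ((𝓡 2).prod 𝓘(ℝ, EuclideanSpace ℝ (Fin 2) →L[ℝ] EuclideanSpace ℝ (Fin 2) →L[ℝ] ℝ)) ∞
    (fun x : M ↦ TotalSpace.mk' (EuclideanSpace ℝ (Fin 2) →L[ℝ] EuclideanSpace ℝ (Fin 2) →L[ℝ] ℝ)
      (E := fun x : M ↦ TangentSpace (𝓡 2) x →L[ℝ] TangentSpace (𝓡 2) x →L[ℝ] ℝ) x (form x))

namespace VolumeForm

variable (ε : VolumeForm M)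

/-- The component `ε_{01}` in the standard basis; then `ε^{01} = 1 / ε_{01}`, in accordance with
`ε^{ac} ε_{bc} = δ^a_b`. -/
def comp (x : M) : ℝ := ε.form x (tangentBasis x 0) (tangentBasis x 1)

/-- The contraction `ε^{ab} T_{ab}`. -/
def contract (x : M) (T : TangentSpace (𝓡 2) x → TangentSpace (𝓡 2) x → ℝ) : ℝ :=
  (T (tangentBasis x 0) (tangentBasis x 1) - T (tangentBasis x 1) (tangentBasis x 0)) / ε.comp x

/-- Raising an index: `X^a = ε^{ab} θ_b`. -/
def sharp (x : M) (θ : TangentSpace (𝓡 2) x → ℝ) : TangentSpace (𝓡 2) x :=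
  (θ (tangentBasis x 1) / ε.comp x) • tangentBasis x 0
    - (θ (tangentBasis x 0) / ε.comp x) • tangentBasis x 1

end VolumeForm

/-- A scale of a projective structure: a volume form `ε` together with a connection `∇` in the
projective class such that `∇_a ε_{bc} = 0`. -/
structure Scale (p : ProjectiveStructure M) where
  /-- The special connection. -/
  conn : AffineConnection M
  mem : conn ∈ p.conns
  /-- The parallel volume form. -/
  vol : VolumeForm M
  parallel : ∀ (x : M) (u v w : TangentSpace (𝓡 2) x),
    covBilin conn (fun y a b ↦ vol.form y a b) x u v w = 0

namespace Scale

variable {p : ProjectiveStructure M} (s : Scale p)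

/-- The one-form `Y_a = ε^{bc} Y_{bca}`. -/
def Ylow (x : M) (u : TangentSpace (𝓡 2) x) : ℝ :=
  s.vol.contract x (fun v w ↦ cotton s.conn x v w u)

/-- The vector field `Y^a = ε^{ab} Y_b`. -/
def Y : VectorField M := fun x ↦ s.vol.sharp x (s.Ylow x)

/-- `φ = 2 ∇_a Y^a`. -/
def phi (x : M) : ℝ := 2 * divergence s.conn s.Y x

/-- `W^a = Y^b ∇_b Y^a - (2φ/3) Y^a`. -/
def W : VectorField M := fun x ↦ s.conn s.Y x (s.Y x) - (2 * s.phi x / 3) • s.Y x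

/-- `W_b = W^a ε_{ab}`. -/
def Wlow (x : M) (u : TangentSpace (𝓡 2) x) : ℝ := s.vol.form x (s.W x) u

/-- `ρ = Y_a W^a`. -/
def rho (x : M) : ℝ := s.Ylow x (s.W x)

/-- `ℓ = 5φ²/12 + 3 P_{ab} Y^a Y^b - (Y^a ∇_a φ)/2`. -/
def ell (x : M) : ℝ :=
  5 * s.phi x ^ 2 / 12 + 3 * schouten s.conn x (s.Y x) (s.Y x) - along s.Y s.phi x / 2

/-- `dY A B` is `A^a B^b ∇_a Y_b`. -/
def dY (A B : VectorField M) (x : M) : ℝ := covOneForm s.conn s.Ylow x (A x) (B x)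

/-- `dW A B` is `A^a B^b ∇_a W_b`. -/
def dW (A B : VectorField M) (x : M) : ℝ := covOneForm s.conn s.Wlow x (A x) (B x)

/-- `F = ε^{ab} ∇_{[a} α_{b]}`. -/
def F (α : OneForm M) (x : M) : ℝ :=
  s.vol.contract x (fun u v ↦
    (covOneForm s.conn (fun y ↦ α y) x u v - covOneForm s.conn (fun y ↦ α y) x v u) / 2)

/-- The coefficient of degree `4` of `P₁`. -/
def a₁ (x : M) : ℝ := 15 * (along s.Y s.rho x / s.rho x - 5 * s.phi x / 2)

/-- The coefficient of degree `2` of `P₁`. -/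
def a₂ (x : M) : ℝ :=
  -(3 * along s.W s.rho x / s.rho x + 6 * s.ell x - 3 * divergence s.conn s.W x)

/-- The constant coefficient of `P₁`. -/
def a₃ (x : M) : ℝ :=
  along s.W s.phi x / 2 + s.phi x / 2 * divergence s.conn s.W x + along s.Y s.ell x
    + s.phi x * s.ell x / 2 - s.phi x * along s.W s.rho x / (2 * s.rho x)
    - s.ell x * along s.Y s.rho x / s.rho x

/-- The coefficient of degree `4` of `P₂`. -/
def b₁ (x : M) : ℝ := -5 * s.dW s.W s.Y x / s.rho x + 50 * s.ell x / 3

/-- The coefficient of degree `2` of `P₂`. -/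
def b₂ (x : M) : ℝ := s.dW s.W s.W x / s.rho x

/-- The constant coefficient of `P₂`. -/
def b₃ (x : M) : ℝ :=
  s.phi x * s.dW s.W s.W x / (6 * s.rho x) + schouten s.conn x (s.W x) (s.W x)
    + s.ell x ^ 2 / 9 + s.ell x * s.dW s.W s.Y x / (3 * s.rho x) + along s.W s.ell x / 3

/-- The coefficient of degree `4` of `P₃`. -/
def c₁ (x : M) : ℝ :=
  -5 * (s.dY s.W s.Y x + s.dW s.Y s.Y x) / (2 * s.rho x) - 25 * s.phi x / 6

/-- The coefficient of degree `2` of `P₃`. -/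
def c₂ (x : M) : ℝ :=
  2 * s.ell x / 3 + (s.dY s.W s.W x + s.dW s.Y s.W x) / (2 * s.rho x)

/-- The constant coefficient of `P₃`. -/
def c₃ (x : M) : ℝ :=
  -along s.W s.phi x / 12 + s.phi x * s.dY s.W s.W x / (12 * s.rho x)
    + s.ell x * s.dY s.W s.Y x / (6 * s.rho x) + schouten s.conn x (s.W x) (s.Y x)
    + along s.Y s.ell x / 6 + s.phi x * s.dW s.Y s.W x / (12 * s.rho x)
    - s.ell x * s.phi x / 18 + s.ell x * s.dW s.Y s.Y x / (6 * s.rho x)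

open Polynomial in
/-- `P₁(t) = -90 t⁶ + a₁ t⁴ + a₂ t² - 9ρ t + a₃` at the point `x`. -/
def P₁ (x : M) : ℝ[X] :=
  C (-90) * X ^ 6 + C (s.a₁ x) * X ^ 4 + C (s.a₂ x) * X ^ 2 - C (9 * s.rho x) * X + C (s.a₃ x)

open Polynomial in
/-- `P₂(t) = -275 t⁸ + b₁ t⁴ + 20ρ t³ + b₂ t² + b₃` at the point `x`. -/
def P₂ (x : M) : ℝ[X] :=
  C (-275) * X ^ 8 + C (s.b₁ x) * X ^ 4 + C (20 * s.rho x) * X ^ 3 + C (s.b₂ x) * X ^ 2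
    + C (s.b₃ x)

open Polynomial in
/-- `P₃(t) = -40 t⁶ + c₁ t⁴ + c₂ t² + ρ t + c₃` at the point `x`. -/
def P₃ (x : M) : ℝ[X] :=
  C (-40) * X ^ 6 + C (s.c₁ x) * X ^ 4 + C (s.c₂ x) * X ^ 2 + C (s.rho x) * X + C (s.c₃ x)

end Scale

end ProjSurface

end

open scoped Topology

noncomputable section

namespace ProjSurface

section

/-- The first-order calculus of a surface with a special torsion-free connection `D` and a parallel
volume form `ε`: functions form the algebra `A`, vector fields the `A`-module `X`, and vector fields
act on functions by `L`. The field `P` is the Schouten tensor, `Y` the dual of its Cotton tensor and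
`φ` twice the divergence of `Y`. -/
structure SurfaceCalculus {A X : Type*} [CommRing A] [Algebra ℝ A] [AddCommGroup X] [Module A X]
    (L : X →ₗ[A] Derivation ℝ A A) where
  D : X → X → X
  D_add_left : ∀ U V Z : X, D (U + V) Z = D U Z + D V Z
  D_smul_left : ∀ (f : A) (U Z : X), D (f • U) Z = f • D U Z
  D_add_right : ∀ U V Z : X, D U (V + Z) = D U V + D U Z
  D_smul_right : ∀ (f : A) (U Z : X), D U (f • Z) = f • D U Z + L U f • Z
  L_comm : ∀ (U V : X) (f : A), L U (L V f) - L V (L U f) = L (D U V) f - L (D V U) f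
  ε : X →ₗ[A] X →ₗ[A] A
  ε_self : ∀ U, ε U U = 0
  ε_parallel : ∀ U V Z, L U (ε V Z) = ε (D U V) Z + ε V (D U Z)
  ε_expand : ∀ U V Z, ε U V • Z = ε Z V • U + ε U Z • V
  P : X →ₗ[A] X →ₗ[A] A
  P_symm : ∀ U V, P U V = P V U
  curv : ∀ U V Z, D U (D V Z) - D V (D U Z) - (D (D U V) Z - D (D V U) Z)
    = P V Z • U - P U Z • V
  Y : X
  cotton : ∀ U V Z, 2 * ((L U (P V Z) - P (D U V) Z - P V (D U Z))
    - (L V (P U Z) - P (D V U) Z - P U (D V Z))) = ε U V * ε Y Z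
  φ : A
  div_Y : ∀ U V, 2 * (ε (D U Y) V + ε U (D V Y)) = φ * ε U V

namespace SurfaceCalculus

variable {A X : Type*} [CommRing A] [Algebra ℝ A] [AddCommGroup X] [Module A X]
  {L : X →ₗ[A] Derivation ℝ A A} (c : SurfaceCalculus L)

/-- The vector field `W = ∇_Y Y - (2φ/3) Y`. -/
def W : X := c.D c.Y c.Y - ((2 / 3 : ℝ) • c.φ) • c.Y

/-- The function `ρ = ε(Y, W)`. -/
def ρ : A := c.ε c.Y c.W

/-- The function `ℓ = 5φ²/12 + 3 P(Y, Y) - Y(φ)/2`. -/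
def ℓ : A := (5 / 12 : ℝ) • c.φ ^ 2 + 3 * c.P c.Y c.Y - (1 / 2 : ℝ) • L c.Y c.φ

lemma ε_swap (U V : X) : c.ε U V = - c.ε V U := by
  have := c.ε_self (U + V)
  simp only [map_add, LinearMap.add_apply, c.ε_self] at this
  linear_combination this

lemma form_expand (α : X →ₗ[A] A) (U V Z : X) :
    c.ε U V * α Z = c.ε Z V * α U + c.ε U Z * α V := by
  simpa using congrArg α (c.ε_expand U V Z)

lemma three_smul_W : (3 : A) • c.W = (3 : A) • c.D c.Y c.Y - (2 * c.φ) • c.Y := by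
  have h : (3 : A) * ((2 / 3 : ℝ) • c.φ) = 2 * c.φ := by
    rw [mul_smul_comm, ← smul_mul_assoc,
      show ((2 / 3 : ℝ) • (3 : A)) = 2 by
        rw [Algebra.smul_def, ← map_ofNat (algebraMap ℝ A) 3, ← map_mul,
          ← map_ofNat (algebraMap ℝ A) 2]
        norm_num]
  rw [W, smul_sub, smul_smul, h]

lemma twelve_mul_ℓ :
    12 * c.ℓ = 5 * c.φ ^ 2 + 36 * c.P c.Y c.Y - 6 * L c.Y c.φ := by
  have h5 : (12 : A) * algebraMap ℝ A (5 / 12) = 5 := by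
    rw [← map_ofNat (algebraMap ℝ A) 12, ← map_mul, ← map_ofNat (algebraMap ℝ A) 5]
    norm_num
  have h6 : (12 : A) * algebraMap ℝ A (1 / 2) = 6 := by
    rw [← map_ofNat (algebraMap ℝ A) 12, ← map_mul, ← map_ofNat (algebraMap ℝ A) 6]
    norm_num
  rw [ℓ, Algebra.smul_def, Algebra.smul_def]
  linear_combination c.φ ^ 2 * h5 - L c.Y c.φ * h6

section EinsteinWeyl

variable {α : X →ₗ[A] A} {F : A}

/-- The projective Einstein-Weyl equation with the skew part of `∇ α` split off. -/
def IsEinsteinWeyl (α : X →ₗ[A] A) (F : A) : Prop :=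
  ∀ U V, 2 * (L U (α V) - α (c.D U V) + α U * α V + c.P U V) = F * c.ε U V

variable (h : c.IsEinsteinWeyl α F)
include h

lemma L_F_aux (U V Z : X) :
    (L U F + 3 * F * α U + c.ε c.Y U) * c.ε V Z - (L V F + 3 * F * α V + c.ε c.Y V) * c.ε U Z
      = 0 := by
  have e1 := congrArg (L U) (h V Z)
  have e2 := congrArg (L V) (h U Z)
  have e3 := c.L_comm U V (α Z)
  have e4 := congrArg α (c.curv U V Z)
  have e5 := c.cotton U V Z
  have h1 := h U Z
  have h2 := h V Z
  have h3 := h U V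
  have h4 := h V U
  have h5 := h (c.D U V) Z
  have h6 := h (c.D V U) Z
  have h7 := h U (c.D V Z)
  have h8 := h V (c.D U Z)
  have x1 := c.form_expand α U V Z
  have x2 := c.form_expand (c.ε c.Y) U V Z
  have s1 := c.ε_swap V U
  have s2 := c.ε_swap Z V
  have p1 := c.ε_parallel U V Z
  have p2 := c.ε_parallel V U Z
  have m2 : ∀ (U : X), L U (2 : A) = 0 := fun U ↦ by
    simpa using (L U).map_natCast 2
  simp only [Derivation.leibniz, map_add, map_sub, map_smul, smul_eq_mul, m2, p1, p2, mul_zero,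
    add_zero] at e1 e2 e4
  linear_combination -(e1 - e2 + h7 - h8 - h5 + h6 - α Z * (h3 - h4) - α V * h1 + α U * h2)
    + 2 * e3 - 2 * e4 + e5 + 2 * F * x1 + x2
    + (2 * F * α U + c.ε c.Y U) * s2 - F * α Z * s1 + 2 * α Z * c.P_symm V U

variable (hρ : IsUnit c.ρ)
include hρ

lemma L_F (U : X) : L U F = -3 * F * α U - c.ε c.Y U := by
  have hY : L c.Y F + 3 * F * α c.Y + c.ε c.Y c.Y = 0 := by
    refine hρ.mul_left_cancel ?_
    have h1 := c.L_F_aux h c.Y c.W c.Y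
    have h2 := c.ε_swap c.Y c.W
    rw [c.ε_self] at h1
    rw [mul_zero, c.ε_self, ρ]
    linear_combination -h1 + (L c.Y F + 3 * F * α c.Y) * h2
  have hU : L U F + 3 * F * α U + c.ε c.Y U = 0 := by
    refine hρ.mul_left_cancel ?_
    have h1 := c.L_F_aux h U c.Y c.W
    rw [ρ]
    linear_combination h1 + c.ε U c.W * hY
  linear_combination hU

lemma six_mul_α_Y : 6 * α c.Y = -6 * F ^ 2 - c.φ := by
  refine hρ.mul_left_cancel ?_
  have h1 := c.L_comm c.Y c.W F
  have h2 := congrArg (L c.Y) (c.L_F h hρ c.W)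
  have h3 := congrArg (L c.W) (c.L_F h hρ c.Y)
  have h4 := c.L_F h hρ c.Y
  have h5 := c.L_F h hρ c.W
  have h6 := c.L_F h hρ (c.D c.Y c.W)
  have h7 := c.L_F h hρ (c.D c.W c.Y)
  have h8 := h c.Y c.W
  have h9 := h c.W c.Y
  have m3 : ∀ U : X, L U (-3 : A) = 0 := fun U ↦ by
    simpa using (L U).map_intCast (-3)
  have h10 := c.div_Y c.Y c.W
  simp only [Derivation.leibniz, map_sub, map_zero, smul_eq_mul, m3, mul_zero,
    add_zero, c.ε_parallel, c.ε_self] at h2 h3 h4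
  rw [ρ]
  linear_combination -2 * h1 + 2 * h2 - 2 * h3 - 2 * h6 + 2 * h7 - 6 * α c.W * h4
    + 6 * α c.Y * h5 - 3 * F * h8 + 3 * F * h9 - h10
    + 3 * F ^ 2 * c.ε_swap c.W c.Y + 6 * F * c.P_symm c.Y c.W

lemma three_mul_α_W : 3 * α c.W = -15 * F ^ 4 + c.ℓ := by
  have h12 : IsUnit (12 : A) := by
    have := (IsUnit.mk0 (12 : ℝ) (by norm_num)).map (algebraMap ℝ A)
    rwa [map_ofNat] at this
  refine h12.mul_left_cancel ?_
  have a6 := c.six_mul_α_Y h hρ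
  have h1 := congrArg (L c.Y) a6
  have h2 := c.L_F h hρ c.Y
  have h3 := h c.Y c.Y
  have h4 := congrArg α c.three_smul_W
  have m6 : L c.Y (6 : A) = 0 := by simpa using (L c.Y).map_natCast 6
  have n6 : L c.Y (-6 : A) = 0 := by simpa using (L c.Y).map_intCast (-6)
  simp only [Derivation.leibniz, Derivation.leibniz_pow, map_sub, map_smul, smul_eq_mul, m6, n6,
    mul_zero, add_zero, c.ε_self, sub_zero, nsmul_eq_mul,
    Nat.cast_ofNat, Nat.add_one_sub_one,
    pow_one] at h1 h2 h3 h4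
  linear_combination 12 * h4 - 18 * h3 + 6 * h1 - 72 * F * h2 - c.twelve_mul_ℓ
    + (36 * F ^ 2 + 6 * α c.Y - 6 * F ^ 2 - c.φ - 4 * c.φ) * a6

lemma constraint_YW :
    2 * c.ρ * (180 * F ^ 4 * α c.Y + L c.Y c.ℓ + 3 * α c.Y * α c.W + 3 * c.P c.Y c.W)
      = 6 * (c.ε (c.D c.Y c.W) c.W * α c.Y + c.ε c.Y (c.D c.Y c.W) * α c.W)
        + 3 * F * c.ρ ^ 2 := by
  have h1 := congrArg (L c.Y) (c.three_mul_α_W h hρ)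
  have h2 := c.L_F h hρ c.Y
  have h3 := h c.Y c.W
  have h4 := c.form_expand α c.Y c.W (c.D c.Y c.W)
  have m3 : L c.Y (3 : A) = 0 := by simpa using (L c.Y).map_natCast 3
  have n15 : L c.Y (-15 : A) = 0 := by simpa using (L c.Y).map_intCast (-15)
  simp only [Derivation.leibniz, Derivation.leibniz_pow, map_add, smul_eq_mul, m3, n15, mul_zero,
    add_zero, c.ε_self, sub_zero, nsmul_eq_mul, Nat.cast_ofNat, Nat.add_one_sub_one] at h1 h2
  rw [ρ]
  linear_combination c.ε c.Y c.W * (3 * h3 - 2 * h1 + 120 * F ^ 3 * h2) + 6 * h4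

lemma constraint_WY :
    c.ρ * (36 * F ^ 2 * α c.W + 12 * F * c.ρ - L c.W c.φ + 6 * α c.Y * α c.W + 6 * c.P c.W c.Y)
      = 6 * (c.ε (c.D c.W c.Y) c.W * α c.Y + c.ε c.Y (c.D c.W c.Y) * α c.W)
        - 3 * F * c.ρ ^ 2 := by
  have h1 := congrArg (L c.W) (c.six_mul_α_Y h hρ)
  have h2 := c.L_F h hρ c.W
  have h3 := h c.W c.Y
  have h4 := c.form_expand α c.Y c.W (c.D c.W c.Y)
  have h5 := c.ε_swap c.W c.Y
  have m6 : L c.W (6 : A) = 0 := by simpa using (L c.W).map_natCast 6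
  have n6 : L c.W (-6 : A) = 0 := by simpa using (L c.W).map_intCast (-6)
  simp only [Derivation.leibniz, Derivation.leibniz_pow, map_sub, smul_eq_mul, m6, n6, mul_zero,
    add_zero, nsmul_eq_mul,
    Nat.cast_ofNat, Nat.add_one_sub_one, pow_one] at h1
  rw [ρ]
  linear_combination c.ε c.Y c.W * (3 * h3 - h1 + 12 * F * h2) + 6 * h4 + 3 * c.ε c.Y c.W * F * h5

lemma constraint_WW :
    c.ρ * (180 * F ^ 4 * α c.W + 60 * F ^ 3 * c.ρ + L c.W c.ℓ + 3 * α c.W ^ 2 + 3 * c.P c.W c.W)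
      = 3 * (c.ε (c.D c.W c.W) c.W * α c.Y + c.ε c.Y (c.D c.W c.W) * α c.W) := by
  have h0 : IsUnit (2 : A) := by
    have := (IsUnit.mk0 (2 : ℝ) (by norm_num)).map (algebraMap ℝ A)
    rwa [map_ofNat] at this
  refine h0.mul_left_cancel ?_
  have h1 := congrArg (L c.W) (c.three_mul_α_W h hρ)
  have h2 := c.L_F h hρ c.W
  have h3 := h c.W c.W
  have h4 := c.form_expand α c.Y c.W (c.D c.W c.W)
  have m3 : L c.W (3 : A) = 0 := by simpa using (L c.W).map_natCast 3
  have n15 : L c.W (-15 : A) = 0 := by simpa using (L c.W).map_intCast (-15)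
  simp only [Derivation.leibniz, Derivation.leibniz_pow, map_add, smul_eq_mul, m3, n15, mul_zero,
    add_zero, c.ε_self, nsmul_eq_mul, Nat.cast_ofNat, Nat.add_one_sub_one] at h1 h3
  rw [ρ]
  linear_combination c.ε c.Y c.W * (3 * h3 - 2 * h1 + 120 * F ^ 3 * h2) + 6 * h4

end EinsteinWeyl
end SurfaceCalculus

end

section

namespace SurfaceCalculus

variable {A X : Type*} [CommRing A] [Algebra ℝ A] [AddCommGroup X] [Module A X]
  {L : X →ₗ[A] Derivation ℝ A A}

/-- `c'` arises from `c` by a projective change with one-form `Υ`, and its volume form is `r` times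
that of `c`. -/
structure IsChange (c c' : SurfaceCalculus L) (Υ : X →ₗ[A] A) (r s : A) : Prop where
  mul_inv : r * s = 1
  D_eq : ∀ U V, c'.D U V = c.D U V + Υ U • V + Υ V • U
  ε_eq : ∀ U V, c'.ε U V = r * c.ε U V

namespace IsChange

variable {c c' : SurfaceCalculus L} {Υ : X →ₗ[A] A} {r s : A} (h : IsChange c c' Υ r s)
  (hρ : IsUnit c.ρ)
include h

lemma isUnit : IsUnit r := IsUnit.of_mul_eq_one s h.mul_inv

include hρ

lemma L_r (U : X) : L U r = 3 * r * Υ U := by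
  refine hρ.mul_left_cancel ?_
  have h1 := c'.ε_parallel U c.Y c.W
  have h2 := c.form_expand Υ c.Y c.W U
  have h3 := c.ε_parallel U c.Y c.W
  simp only [h.D_eq, h.ε_eq, Derivation.leibniz, map_add, map_smul, smul_eq_mul, h3,
    LinearMap.add_apply, LinearMap.smul_apply] at h1
  rw [ρ]
  linear_combination h1 - r * h2

lemma L_s (U : X) : L U s = - 3 * s * Υ U := by
  refine h.isUnit.mul_left_cancel ?_
  have h1 := congrArg (L U) h.mul_inv
  simp only [Derivation.leibniz, smul_eq_mul, h.L_r hρ, Derivation.map_one_eq_zero] at h1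
  linear_combination h1

lemma closed (U V : X) : L U (Υ V) - L V (Υ U) = Υ (c.D U V) - Υ (c.D V U) := by
  have h3 : IsUnit (3 : A) := by
    have := (IsUnit.mk0 (3 : ℝ) (by norm_num)).map (algebraMap ℝ A)
    rwa [map_ofNat] at this
  refine (h3.mul h.isUnit).mul_left_cancel ?_
  have h1 := c.L_comm U V r
  have m3 : ∀ U : X, L U (3 : A) = 0 := fun U ↦ by simpa using (L U).map_natCast 3
  simp only [h.L_r hρ, Derivation.leibniz, smul_eq_mul, m3] at h1
  linear_combination h1

lemma P_eq (V Z : X) : c'.P V Z = c.P V Z - (L V (Υ Z) - Υ (c.D V Z)) + Υ V * Υ Z := by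
  have key : ∀ U V Z, (c'.P V Z - (c.P V Z - (L V (Υ Z) - Υ (c.D V Z)) + Υ V * Υ Z)) • U
      = (c'.P U Z - (c.P U Z - (L U (Υ Z) - Υ (c.D U Z)) + Υ U * Υ Z)) • V := by
    intro U V Z
    have h1 := c'.curv U V Z
    have h2 := c.curv U V Z
    have h3 := congrArg (· • Z) (h.closed hρ U V)
    simp only [h.D_eq, c.D_add_right, c.D_add_left, c.D_smul_left, c.D_smul_right, map_add,
      map_smul, smul_eq_mul] at h1
    simp only [sub_smul] at h3
    linear_combination (norm := module) h2 - h1 + h3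
  have hW : c'.P c.W Z - (c.P c.W Z - (L c.W (Υ Z) - Υ (c.D c.W Z)) + Υ c.W * Υ Z) = 0 := by
    refine hρ.mul_left_cancel ?_
    have := congrArg (fun T ↦ c.ε T c.W) (key c.Y c.W Z)
    simp only [map_smul, LinearMap.smul_apply, c.ε_self, smul_eq_mul, mul_zero] at this
    rw [ρ]
    linear_combination this
  have hV : c'.P V Z - (c.P V Z - (L V (Υ Z) - Υ (c.D V Z)) + Υ V * Υ Z) = 0 := by
    refine hρ.mul_left_cancel ?_
    have := congrArg (c.ε c.Y) (key c.W V Z)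
    rw [hW] at this
    simp only [map_smul, zero_smul, map_zero, smul_eq_mul] at this
    rw [ρ]
    linear_combination this
  linear_combination hV

lemma cotton_eq (U V Z : X) : r ^ 2 * c.ε U V * c.ε c'.Y Z = c.ε U V * c.ε c.Y Z := by
  have h1 := c'.cotton U V Z
  have h2 := c.cotton U V Z
  have h3 := c.L_comm U V (Υ Z)
  have h4 := congrArg Υ (c.curv U V Z)
  have h5 := h.closed hρ U V
  have s1 := c.P_symm U V
  simp only [h.D_eq, h.ε_eq, h.P_eq hρ, map_add, map_sub, map_smul, LinearMap.add_apply,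
    LinearMap.smul_apply, smul_eq_mul, Derivation.leibniz, c.D_add_right, c.D_smul_right] at h1
  simp only [map_sub, map_smul, smul_eq_mul] at h4
  linear_combination h2 - h1 - 2 * h3 + 2 * h4 + 2 * Υ Z * s1

lemma Y_eq : c'.Y = s ^ 2 • c.Y := by
  have key : ∀ Z, c.ε (c'.Y - s ^ 2 • c.Y) Z = 0 := by
    intro Z
    refine ((h.isUnit.pow 2).mul hρ).mul_left_cancel ?_
    have h1 := h.cotton_eq hρ c.Y c.W Z
    simp only [map_sub, map_smul, LinearMap.sub_apply, LinearMap.smul_apply, smul_eq_mul, ρ]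
    linear_combination h1 - c.ε c.Y c.W * c.ε c.Y Z * (r * s + 1) * h.mul_inv
  have h2 := c.ε_expand c.Y c.W (c'.Y - s ^ 2 • c.Y)
  rw [key, c.ε_swap c.Y (c'.Y - s ^ 2 • c.Y), key, neg_zero, zero_smul, zero_smul, add_zero] at h2
  rw [← sub_eq_zero]
  exact (hρ.smul_eq_zero).1 h2

lemma φ_eq : c'.φ = s ^ 2 * (c.φ - 6 * Υ c.Y) := by
  refine (h.isUnit.mul hρ).mul_left_cancel ?_
  have h1 := c'.div_Y c.Y c.W
  have h2 := c.div_Y c.Y c.W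
  have h3 := c.form_expand Υ c.Y c.W c.Y
  simp only [h.D_eq, h.ε_eq, h.Y_eq hρ, map_add, map_smul, LinearMap.add_apply,
    LinearMap.smul_apply, smul_eq_mul, c.D_smul_right, Derivation.leibniz_pow,
    h.L_s hρ, nsmul_eq_mul,
    Nat.cast_ofNat, Nat.add_one_sub_one, pow_one, c.ε_self] at h1
  rw [ρ]
  linear_combination r * s ^ 2 * h2 - h1

lemma W_eq : c'.W = s ^ 4 • c.W := by
  have h0 : IsUnit (3 : A) := by
    have := (IsUnit.mk0 (3 : ℝ) (by norm_num)).map (algebraMap ℝ A)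
    rwa [map_ofNat] at this
  have h1 := c'.three_smul_W
  have h2 := c.three_smul_W
  have h3 : (3 : A) • (c'.W - s ^ 4 • c.W) = 0 := by
    simp only [h.D_eq, h.φ_eq hρ, h.Y_eq hρ, map_smul, smul_eq_mul, c.D_smul_left, c.D_smul_right,
      Derivation.leibniz_pow, h.L_s hρ, nsmul_eq_mul,
    Nat.cast_ofNat, Nat.add_one_sub_one,
      pow_one] at h1
    linear_combination (norm := module) h1 - s ^ 4 • h2
  exact sub_eq_zero.1 ((h0.smul_eq_zero).1 h3)

lemma ρ_eq : c'.ρ = s ^ 5 * c.ρ := by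
  simp only [ρ, h.ε_eq, h.Y_eq hρ, h.W_eq hρ, map_smul, LinearMap.smul_apply, smul_eq_mul]
  linear_combination s ^ 5 * c.ε c.Y c.W * h.mul_inv

lemma ℓ_eq : c'.ℓ = s ^ 4 * (c.ℓ + 3 * Υ c.W) := by
  have h12 : IsUnit (12 : A) := by
    have := (IsUnit.mk0 (12 : ℝ) (by norm_num)).map (algebraMap ℝ A)
    rwa [map_ofNat] at this
  refine h12.mul_left_cancel ?_
  have h1 := c'.twelve_mul_ℓ
  have h2 := c.twelve_mul_ℓ
  have h3 := congrArg Υ c.three_smul_W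
  have m6 : L c.Y (6 : A) = 0 := by simpa using (L c.Y).map_natCast 6
  simp only [h.P_eq hρ, h.φ_eq hρ, h.Y_eq hρ, map_smul, smul_eq_mul, map_sub,
    LinearMap.smul_apply, Derivation.leibniz, m6, Derivation.leibniz_pow, h.L_s hρ, nsmul_eq_mul,
    Nat.cast_ofNat, Nat.add_one_sub_one,
    pow_one, Derivation.smul_apply] at h1 h3
  linear_combination h1 - s ^ 4 * h2 - 12 * s ^ 4 * h3

lemma L_Y_ρ : L c'.Y c'.ρ = s ^ 7 * (L c.Y c.ρ - 15 * Υ c.Y * c.ρ) := by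
  simp only [h.ρ_eq hρ, h.Y_eq hρ, map_smul, Derivation.smul_apply, smul_eq_mul,
    Derivation.leibniz, Derivation.leibniz_pow, h.L_s hρ, nsmul_eq_mul, Nat.cast_ofNat,
    Nat.add_one_sub_one]
  ring

lemma L_W_ρ : L c'.W c'.ρ = s ^ 9 * (L c.W c.ρ - 15 * Υ c.W * c.ρ) := by
  simp only [h.ρ_eq hρ, h.W_eq hρ, map_smul, Derivation.smul_apply, smul_eq_mul,
    Derivation.leibniz, Derivation.leibniz_pow, h.L_s hρ, nsmul_eq_mul, Nat.cast_ofNat,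
    Nat.add_one_sub_one]
  ring

lemma L_W_φ : L c'.W c'.φ
    = s ^ 6 * (L c.W c.φ - 6 * L c.W (Υ c.Y) - 6 * Υ c.W * (c.φ - 6 * Υ c.Y)) := by
  have m6 : L c.W (6 : A) = 0 := by simpa using (L c.W).map_natCast 6
  simp only [h.φ_eq hρ, h.W_eq hρ, map_smul, Derivation.smul_apply, smul_eq_mul, map_sub, m6,
    Derivation.leibniz, Derivation.leibniz_pow, h.L_s hρ, nsmul_eq_mul, Nat.cast_ofNat,
    Nat.add_one_sub_one]
  ring

lemma L_ℓ (U : X) : L U c'.ℓ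
    = s ^ 4 * (L U c.ℓ + 3 * L U (Υ c.W) - 12 * Υ U * (c.ℓ + 3 * Υ c.W)) := by
  have m3 : L U (3 : A) = 0 := by simpa using (L U).map_natCast 3
  simp only [h.ℓ_eq hρ, smul_eq_mul, map_add, m3,
    Derivation.leibniz, Derivation.leibniz_pow, h.L_s hρ, nsmul_eq_mul, Nat.cast_ofNat,
    Nat.add_one_sub_one]
  ring

lemma ε_D_Y (U V : X) : c'.ε (c'.D U c'.Y) V
    = s * (c.ε (c.D U c.Y) V - 5 * Υ U * c.ε c.Y V + Υ c.Y * c.ε U V) := by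
  simp only [h.D_eq, h.ε_eq, h.Y_eq hρ, map_add, map_smul, LinearMap.add_apply,
    LinearMap.smul_apply, smul_eq_mul, c.D_smul_right, Derivation.leibniz_pow,
    h.L_s hρ, nsmul_eq_mul,
    Nat.cast_ofNat, Nat.add_one_sub_one, pow_one]
  linear_combination s * (c.ε (c.D U c.Y) V - 5 * Υ U * c.ε c.Y V + Υ c.Y * c.ε U V) * h.mul_inv

lemma ε_D_W (U V : X) : c'.ε (c'.D U c'.W) V
    = s ^ 3 * (c.ε (c.D U c.W) V - 11 * Υ U * c.ε c.W V + Υ c.W * c.ε U V) := by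
  simp only [h.D_eq, h.ε_eq, h.W_eq hρ, map_add, map_smul, LinearMap.add_apply,
    LinearMap.smul_apply, smul_eq_mul, c.D_smul_right, Derivation.leibniz_pow,
    h.L_s hρ, nsmul_eq_mul, Nat.cast_ofNat, Nat.add_one_sub_one]
  linear_combination s ^ 3 * (c.ε (c.D U c.W) V - 11 * Υ U * c.ε c.W V + Υ c.W * c.ε U V)
    * h.mul_inv

end IsChange
end SurfaceCalculus

end

section

namespace SurfaceCalculus

variable {A X : Type*} [CommRing A] [Algebra ℝ A] [AddCommGroup X] [Module A X]
  {L : X →ₗ[A] Derivation ℝ A A} (c : SurfaceCalculus L) (χ : A →+* ℝ)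

/-! The coefficients of the three polynomials at the point given by `χ`. -/

/-- The value `ε(∇_U Y, V)` at the point `χ`. -/
def dY (U V : X) : ℝ := χ (c.ε (c.D U c.Y) V)

/-- The value `ε(∇_U W, V)` at the point `χ`. -/
def dW (U V : X) : ℝ := χ (c.ε (c.D U c.W) V)

lemma χ_ε_D_Y (U V : X) : χ (c.ε (c.D U c.Y) V) = c.dY χ U V := rfl

lemma χ_ε_D_W (U V : X) : χ (c.ε (c.D U c.W) V) = c.dW χ U V := rfl

/-- The divergence of `W` at the point `χ`, computed in the frame `Y, W`. -/
def divW : ℝ := χ (c.ε (c.D c.Y c.W) c.W + c.ε c.Y (c.D c.W c.W)) / χ c.ρ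

def a₁ : ℝ := 15 * (χ (L c.Y c.ρ) / χ c.ρ - 5 * χ c.φ / 2)

def a₂ : ℝ := -(3 * χ (L c.W c.ρ) / χ c.ρ + 6 * χ c.ℓ - 3 * c.divW χ)

def a₃ : ℝ :=
  χ (L c.W c.φ) / 2 + χ c.φ / 2 * c.divW χ + χ (L c.Y c.ℓ)
    + χ c.φ * χ c.ℓ / 2 - χ c.φ * χ (L c.W c.ρ) / (2 * χ c.ρ)
    - χ c.ℓ * χ (L c.Y c.ρ) / χ c.ρ

def b₁ : ℝ := -5 * c.dW χ c.W c.Y / χ c.ρ + 50 * χ c.ℓ / 3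

def b₂ : ℝ := c.dW χ c.W c.W / χ c.ρ

def b₃ : ℝ :=
  χ c.φ * c.dW χ c.W c.W / (6 * χ c.ρ) + χ (c.P c.W c.W)
    + χ c.ℓ ^ 2 / 9 + χ c.ℓ * c.dW χ c.W c.Y / (3 * χ c.ρ) + χ (L c.W c.ℓ) / 3

def c₁ : ℝ :=
  -5 * (c.dY χ c.W c.Y + c.dW χ c.Y c.Y) / (2 * χ c.ρ) - 25 * χ c.φ / 6

def c₂ : ℝ := 2 * χ c.ℓ / 3 + (c.dY χ c.W c.W + c.dW χ c.Y c.W) / (2 * χ c.ρ)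

def c₃ : ℝ :=
  -χ (L c.W c.φ) / 12 + χ c.φ * c.dY χ c.W c.W / (12 * χ c.ρ)
    + χ c.ℓ * c.dY χ c.W c.Y / (6 * χ c.ρ) + χ (c.P c.W c.Y)
    + χ (L c.Y c.ℓ) / 6 + χ c.φ * c.dW χ c.Y c.W / (12 * χ c.ρ)
    - χ c.ℓ * χ c.φ / 18 + χ c.ℓ * c.dW χ c.Y c.Y / (6 * χ c.ρ)

section EinsteinWeyl

variable {c χ} {α : X →ₗ[A] A} {F : A} (h : c.IsEinsteinWeyl α F) (hρ : IsUnit c.ρ)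
include h hρ

lemma χ_α_Y : χ (α c.Y) = - χ F ^ 2 - χ c.φ / 6 := by
  have := congrArg χ (c.six_mul_α_Y h hρ)
  simp only [map_mul, map_sub, map_pow, map_ofNat, map_neg] at this
  linear_combination this / 6

lemma χ_α_W : χ (α c.W) = -5 * χ F ^ 4 + χ c.ℓ / 3 := by
  have := congrArg χ (c.three_mul_α_W h hρ)
  simp only [map_mul, map_add, map_pow, map_ofNat, map_neg] at this
  linear_combination this / 3

theorem polynomial_one : -90 * χ F ^ 6 + c.a₁ χ * χ F ^ 4 + c.a₂ χ * χ F ^ 2 - 9 * χ c.ρ * χ F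
    + c.a₃ χ = 0 := by
  have h0 : χ c.ρ ≠ 0 := (hρ.map χ).ne_zero
  have h1 := congrArg χ (c.constraint_YW h hρ)
  have h2 := congrArg χ (c.constraint_WY h hρ)
  have h3 := congrArg χ (c.ε_parallel c.Y c.Y c.W)
  have h4 := congrArg χ (c.ε_parallel c.W c.Y c.W)
  have h5 := congrArg χ (c.div_Y c.Y c.W)
  have h7 := congrArg χ (c.P_symm c.W c.Y)
  change χ (L c.Y c.ρ) = _ at h3
  change χ (L c.W c.ρ) = _ at h4
  change _ = χ (c.φ * c.ρ) at h5
  simp only [map_mul, map_sub, map_add, map_pow, map_ofNat, χ_α_Y h hρ, χ_α_W h hρ]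
    at h1 h2 h3 h4 h5
  simp only [a₁, a₂, a₃, divW, map_add, h3, h4]
  field_simp
  linear_combination h1 - h2 + (15 * χ F ^ 4 - χ c.ℓ) * h5 + 6 * χ c.ρ * h7

theorem polynomial_two : -275 * χ F ^ 8 + c.b₁ χ * χ F ^ 4 + 20 * χ c.ρ * χ F ^ 3
    + c.b₂ χ * χ F ^ 2 + c.b₃ χ = 0 := by
  have h0 : χ c.ρ ≠ 0 := (hρ.map χ).ne_zero
  have h1 := congrArg χ (c.constraint_WW h hρ)
  have h2 := congrArg χ (c.ε_swap c.Y (c.D c.W c.W))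
  simp only [map_mul, map_add, map_pow, map_ofNat, map_neg, χ_α_Y h hρ, χ_α_W h hρ] at h1 h2
  simp only [b₁, b₂, b₃, dW]
  field_simp
  linear_combination 54 * h1 + (-810 * χ F ^ 4 + 54 * χ c.ℓ) * h2

theorem polynomial_three : -40 * χ F ^ 6 + c.c₁ χ * χ F ^ 4 + c.c₂ χ * χ F ^ 2 + χ c.ρ * χ F
    + c.c₃ χ = 0 := by
  have h0 : χ c.ρ ≠ 0 := (hρ.map χ).ne_zero
  have h1 := congrArg χ (c.constraint_YW h hρ)
  have h2 := congrArg χ (c.constraint_WY h hρ)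
  have h3 := congrArg χ (c.ε_swap c.Y (c.D c.W c.Y))
  have h4 := congrArg χ (c.ε_swap c.Y (c.D c.Y c.W))
  have h7 := congrArg χ (c.P_symm c.W c.Y)
  simp only [map_mul, map_sub, map_add, map_pow, map_ofNat, map_neg, χ_α_Y h hρ,
    χ_α_W h hρ] at h1 h2 h3 h4
  simp only [c₁, c₂, c₃, dW, dY]
  field_simp
  linear_combination 648 * (h1 + h2) + (-19440 * χ F ^ 4 + 1296 * χ c.ℓ) * (h3 + h4)
    + 3888 * χ c.ρ * h7

end EinsteinWeyl

section FrameRelations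

lemma L_Y_ρ_eq : χ (L c.Y c.ρ) = 2 / 3 * χ c.φ * χ c.ρ - c.dW χ c.Y c.Y := by
  have h1 := congrArg χ (c.ε_parallel c.Y c.Y c.W)
  have h2 := congrArg (fun V ↦ χ (c.ε V c.W)) c.three_smul_W
  have h3 := congrArg χ (c.ε_swap c.Y (c.D c.Y c.W))
  simp only [map_sub, map_smul, LinearMap.sub_apply, LinearMap.smul_apply, c.ε_self, smul_eq_mul,
    mul_zero, map_mul, map_ofNat, map_zero] at h2
  rw [map_add] at h1
  rw [map_neg] at h3
  rw [ρ, dW]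
  linear_combination h1 - h2 / 3 + h3

lemma dY_W_Y_eq : c.dY χ c.W c.Y = χ c.φ * χ c.ρ / 6 := by
  have h1 := congrArg χ (c.div_Y c.Y c.W)
  have h2 := congrArg (fun V ↦ χ (c.ε V c.W)) c.three_smul_W
  have h3 := congrArg χ (c.ε_swap c.Y (c.D c.W c.Y))
  simp only [map_sub, map_smul, LinearMap.sub_apply, LinearMap.smul_apply, c.ε_self, smul_eq_mul,
    mul_zero, map_mul, map_ofNat, map_zero] at h2
  simp only [map_add, map_mul, map_ofNat] at h1
  rw [map_neg] at h3
  rw [ρ, dY]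
  linear_combination -h1 / 2 - h2 / 3 + h3

lemma L_W_ρ_eq : χ (L c.W c.ρ) = c.dY χ c.W c.W - c.dW χ c.W c.Y := by
  have h1 := congrArg χ (c.ε_parallel c.W c.Y c.W)
  have h3 := congrArg χ (c.ε_swap c.Y (c.D c.W c.W))
  rw [map_add] at h1
  rw [map_neg] at h3
  rw [ρ, dW, dY]
  linear_combination h1 + h3

lemma divW_eq_dW : c.divW χ = (c.dW χ c.Y c.W - c.dW χ c.W c.Y) / χ c.ρ := by
  rw [divW, c.ε_swap c.Y, map_add, map_neg, dW, dW]
  ring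

lemma χ_form (β : X →ₗ[A] A) (Z : X) (h0 : χ c.ρ ≠ 0) : χ (β Z)
    = (χ (c.ε Z c.W) * χ (β c.Y) - χ (c.ε Z c.Y) * χ (β c.W)) / χ c.ρ := by
  have h1 := congrArg χ (c.form_expand β c.Y c.W Z)
  rw [c.ε_swap c.Y Z] at h1
  change χ (c.ρ * _) = _ at h1
  simp only [map_mul, map_add, map_neg] at h1
  field_simp
  linear_combination h1

end FrameRelations

namespace IsChange

variable {c c' : SurfaceCalculus L} {Υ : X →ₗ[A] A} {r s : A} (h : IsChange c c' Υ r s)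
  (hρ : IsUnit c.ρ) (χ : A →+* ℝ)
include h

lemma χ_s : χ s = (χ r)⁻¹ := by
  have := congrArg χ h.mul_inv
  rw [map_mul, map_one] at this
  exact eq_inv_of_mul_eq_one_right this

lemma χ_r_ne_zero : χ r ≠ 0 := (h.isUnit.map χ).ne_zero

include hρ

lemma χ_ρ : χ c'.ρ = χ c.ρ / χ r ^ 5 := by
  rw [h.ρ_eq hρ, map_mul, map_pow, h.χ_s]; field_simp

lemma χ_φ : χ c'.φ = (χ c.φ - 6 * χ (Υ c.Y)) / χ r ^ 2 := by
  simp only [h.φ_eq hρ, map_mul, map_pow, h.χ_s, map_sub, map_ofNat]; field_simp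

lemma χ_ℓ : χ c'.ℓ = (χ c.ℓ + 3 * χ (Υ c.W)) / χ r ^ 4 := by
  simp only [h.ℓ_eq hρ, map_mul, map_pow, h.χ_s, map_add, map_ofNat]; field_simp

lemma χ_L_Y_ρ : χ (L c'.Y c'.ρ) = (χ (L c.Y c.ρ) - 15 * χ (Υ c.Y) * χ c.ρ) / χ r ^ 7 := by
  simp only [h.L_Y_ρ hρ, map_mul, map_pow, h.χ_s, map_sub, map_ofNat]; field_simp

lemma χ_L_W_ρ : χ (L c'.W c'.ρ) = (χ (L c.W c.ρ) - 15 * χ (Υ c.W) * χ c.ρ) / χ r ^ 9 := by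
  simp only [h.L_W_ρ hρ, map_mul, map_pow, h.χ_s, map_sub, map_ofNat]; field_simp

lemma χ_L_W_φ : χ (L c'.W c'.φ) = (χ (L c.W c.φ) - 6 * χ (L c.W (Υ c.Y))
    - 6 * χ (Υ c.W) * (χ c.φ - 6 * χ (Υ c.Y))) / χ r ^ 6 := by
  simp only [h.L_W_φ hρ, map_mul, map_pow, h.χ_s, map_sub, map_ofNat]; field_simp

lemma χ_L_Y_ℓ : χ (L c'.Y c'.ℓ) = (χ (L c.Y c.ℓ) + 3 * χ (L c.Y (Υ c.W))
    - 12 * χ (Υ c.Y) * (χ c.ℓ + 3 * χ (Υ c.W))) / χ r ^ 6 := by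
  simp only [h.L_ℓ hρ, h.Y_eq hρ, map_smul, Derivation.smul_apply, smul_eq_mul, map_mul, map_pow,
    h.χ_s, map_sub, map_add, map_ofNat]
  field_simp

lemma χ_L_W_ℓ : χ (L c'.W c'.ℓ) = (χ (L c.W c.ℓ) + 3 * χ (L c.W (Υ c.W))
    - 12 * χ (Υ c.W) * (χ c.ℓ + 3 * χ (Υ c.W))) / χ r ^ 8 := by
  simp only [h.L_ℓ hρ, h.W_eq hρ, map_smul, Derivation.smul_apply, smul_eq_mul, map_mul, map_pow,
    h.χ_s, map_sub, map_add, map_ofNat]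
  field_simp

lemma χ_P_W_W : χ (c'.P c'.W c'.W) = (χ (c.P c.W c.W) - χ (L c.W (Υ c.W))
    + χ (Υ (c.D c.W c.W)) + χ (Υ c.W) ^ 2) / χ r ^ 8 := by
  simp only [h.W_eq hρ, map_smul, LinearMap.smul_apply, h.P_eq hρ, smul_eq_mul,
    map_mul, map_pow, h.χ_s, map_sub, map_add]
  field_simp
  ring

lemma χ_P_W_Y : χ (c'.P c'.W c'.Y) = (χ (c.P c.W c.Y) - χ (L c.W (Υ c.Y))
    + χ (Υ (c.D c.W c.Y)) + χ (Υ c.W) * χ (Υ c.Y)) / χ r ^ 6 := by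
  simp only [h.W_eq hρ, h.Y_eq hρ, map_smul, LinearMap.smul_apply, h.P_eq hρ, smul_eq_mul,
    map_mul, map_pow, h.χ_s, map_sub, map_add]
  field_simp
  ring

lemma dY_W_Y : c'.dY χ c'.W c'.Y = (c.dY χ c.W c.Y - χ (Υ c.Y) * χ c.ρ) / χ r ^ 7 := by
  rw [dY, h.ε_D_Y hρ, h.W_eq hρ, h.Y_eq hρ, dY, ρ]
  simp only [c.D_smul_left, map_smul, LinearMap.smul_apply, c.ε_self, c.ε_swap c.W c.Y,
    smul_eq_mul, map_mul, map_pow, h.χ_s, map_sub, map_add, map_ofNat, map_neg, map_zero]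
  field_simp
  ring

lemma dY_W_W : c'.dY χ c'.W c'.W = (c.dY χ c.W c.W - 5 * χ (Υ c.W) * χ c.ρ) / χ r ^ 9 := by
  rw [dY, h.ε_D_Y hρ, h.W_eq hρ, dY, ρ]
  simp only [c.D_smul_left, map_smul, LinearMap.smul_apply, c.ε_self,
    smul_eq_mul, map_mul, map_pow, h.χ_s, map_sub, map_add, map_ofNat, map_zero]
  field_simp
  ring

lemma dW_Y_Y : c'.dW χ c'.Y c'.Y = (c.dW χ c.Y c.Y + 11 * χ (Υ c.Y) * χ c.ρ) / χ r ^ 7 := by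
  rw [dW, h.ε_D_W hρ, h.Y_eq hρ, dW, ρ]
  simp only [c.D_smul_left, map_smul, LinearMap.smul_apply, c.ε_self, c.ε_swap c.W c.Y,
    smul_eq_mul, map_mul, map_pow, h.χ_s, map_sub, map_add, map_ofNat, map_neg, map_zero]
  field_simp
  ring

lemma dW_Y_W : c'.dW χ c'.Y c'.W = (c.dW χ c.Y c.W + χ (Υ c.W) * χ c.ρ) / χ r ^ 9 := by
  rw [dW, h.ε_D_W hρ, h.W_eq hρ, h.Y_eq hρ, dW, ρ]
  simp only [c.D_smul_left, map_smul, LinearMap.smul_apply, c.ε_self,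
    smul_eq_mul, map_mul, map_pow, h.χ_s, map_sub, map_add, map_ofNat, map_zero]
  field_simp
  ring

lemma dW_W_Y : c'.dW χ c'.W c'.Y = (c.dW χ c.W c.Y + 10 * χ (Υ c.W) * χ c.ρ) / χ r ^ 9 := by
  rw [dW, h.ε_D_W hρ, h.W_eq hρ, h.Y_eq hρ, dW, ρ]
  simp only [c.D_smul_left, map_smul, LinearMap.smul_apply, c.ε_swap c.W c.Y,
    smul_eq_mul, map_mul, map_pow, h.χ_s, map_sub, map_add, map_ofNat, map_neg]
  field_simp
  ring

lemma dW_W_W : c'.dW χ c'.W c'.W = c.dW χ c.W c.W / χ r ^ 11 := by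
  rw [dW, h.ε_D_W hρ, h.W_eq hρ, dW]
  simp only [c.D_smul_left, map_smul, LinearMap.smul_apply, c.ε_self,
    smul_eq_mul, map_mul, map_pow, h.χ_s, map_sub, map_add, map_ofNat, map_zero]
  field_simp
  ring

lemma divW_eq : c'.divW χ = (c.divW χ - 9 * χ (Υ c.W)) / χ r ^ 4 := by
  have h0 : χ c.ρ ≠ 0 := (hρ.map χ).ne_zero
  have hr := h.χ_r_ne_zero χ
  have h1 := h.dW_Y_W hρ χ
  have h2 := h.dW_W_Y hρ χ
  simp only [dW] at h1 h2
  rw [divW, divW, c'.ε_swap c'.Y, c.ε_swap c.Y, h.χ_ρ hρ, map_add, map_add, map_neg,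
    map_neg, h1, h2]
  field_simp
  ring

lemma coeff_one : χ r ^ 2 * c'.a₁ χ = c.a₁ χ ∧ χ r ^ 4 * c'.a₂ χ = c.a₂ χ
    ∧ χ r ^ 6 * c'.a₃ χ = c.a₃ χ := by
  have h0 : χ c.ρ ≠ 0 := (hρ.map χ).ne_zero
  have hr := h.χ_r_ne_zero χ
  have e1 := congrArg χ (h.closed hρ c.Y c.W)
  rw [map_sub, map_sub, c.χ_form χ Υ (c.D c.Y c.W) h0, c.χ_form χ Υ (c.D c.W c.Y) h0,
    sub_eq_iff_eq_add] at e1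
  simp only [χ_ε_D_Y, χ_ε_D_W, dY_W_Y_eq] at e1
  simp only [a₁, a₂, a₃, h.χ_φ hρ, h.χ_ρ hρ, h.χ_L_Y_ρ hρ, h.χ_L_W_ρ hρ, h.χ_ℓ hρ, h.χ_L_Y_ℓ hρ,
    h.χ_L_W_φ hρ, h.divW_eq hρ, e1, L_Y_ρ_eq, L_W_ρ_eq, divW_eq_dW]
  refine ⟨?_, ?_, ?_⟩ <;> field_simp <;> ring

lemma coeff_two : χ r ^ 4 * c'.b₁ χ = c.b₁ χ ∧ χ r ^ 6 * c'.b₂ χ = c.b₂ χ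
    ∧ χ r ^ 8 * c'.b₃ χ = c.b₃ χ := by
  have h0 : χ c.ρ ≠ 0 := (hρ.map χ).ne_zero
  have hr := h.χ_r_ne_zero χ
  have e1 := c.χ_form χ Υ (c.D c.W c.W) h0
  rw [← dW, ← dW] at e1
  simp only [b₁, b₂, b₃, h.χ_φ hρ, h.χ_ρ hρ, h.χ_ℓ hρ, h.χ_L_W_ℓ hρ, h.dW_W_Y hρ, h.dW_W_W hρ,
    h.χ_P_W_W hρ, e1]
  refine ⟨?_, ?_, ?_⟩ <;> field_simp <;> ring

lemma coeff_three : χ r ^ 2 * c'.c₁ χ = c.c₁ χ ∧ χ r ^ 4 * c'.c₂ χ = c.c₂ χ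
    ∧ χ r ^ 6 * c'.c₃ χ = c.c₃ χ := by
  have h0 : χ c.ρ ≠ 0 := (hρ.map χ).ne_zero
  have hr := h.χ_r_ne_zero χ
  have e1 := congrArg χ (h.closed hρ c.Y c.W)
  have e2 := c.χ_form χ Υ (c.D c.W c.Y) h0
  rw [map_sub, map_sub, c.χ_form χ Υ (c.D c.Y c.W) h0, e2, sub_eq_iff_eq_add] at e1
  simp only [χ_ε_D_Y, χ_ε_D_W] at e1 e2
  simp only [c₁, c₂, c₃, h.χ_φ hρ, h.χ_ρ hρ, h.χ_ℓ hρ, h.χ_L_W_φ hρ, h.χ_L_Y_ℓ hρ, h.dW_Y_Y hρ,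
    h.dW_Y_W hρ, h.dY_W_Y hρ, h.dY_W_W hρ, h.χ_P_W_Y hρ, e1, e2]
  refine ⟨?_, ?_, ?_⟩ <;> field_simp <;> ring

end IsChange
end SurfaceCalculus

end

section

section Fields
variable (M : Type*) [TopologicalSpace M] [ChartedSpace (EuclideanSpace ℝ (Fin 2)) M]

/-- The algebra of smooth functions. -/
abbrev SmoothFn : Type _ := C^∞⟮𝓡 2, M; 𝓘(ℝ, ℝ), ℝ⟯

/-- The space of smooth vector fields. -/
abbrev SmoothField [IsManifold (𝓡 2) ∞ M] : Type _ :=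
  Cₛ^∞⟮𝓡 2; EuclideanSpace ℝ (Fin 2), (TangentSpace (𝓡 2) : M → Type _)⟯

variable {M}

lemma SmoothFn.mdiffAt (f : SmoothFn M) (x : M) : MDifferentiableAt (𝓡 2) 𝓘(ℝ, ℝ) f x :=
  f.contMDiff.mdifferentiableAt (by simp)

variable [IsManifold (𝓡 2) ∞ M]

instance : IsManifold (𝓡 2) (minSmoothness ℝ 3) M := by
  rw [minSmoothness_of_isRCLikeNormedField]; infer_instance

namespace SmoothField

instance : Module (SmoothFn M) (SmoothField M) where
  smul f V := ⟨fun x ↦ f x • V x, f.contMDiff.smul_section V.contMDiff⟩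
  one_smul V := by ext x; exact one_smul ℝ (V x)
  mul_smul f g V := by ext x; exact mul_smul (f x) (g x) (V x)
  smul_zero f := by ext x; exact smul_zero (f x)
  smul_add f V Z := by ext x; exact smul_add (f x) (V x) (Z x)
  add_smul f g V := by ext x; exact add_smul (f x) (g x) (V x)
  zero_smul V := by ext x; exact zero_smul ℝ (V x)

lemma smul_apply (f : SmoothFn M) (V : SmoothField M) (x : M) : (f • V) x = f x • V x := rfl

lemma add_apply (U V : SmoothField M) (x : M) : (U + V) x = U x + V x := rfl

lemma sub_apply (U V : SmoothField M) (x : M) : (U - V) x = U x - V x := rfl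

lemma mdiffAt (V : SmoothField M) (x : M) :
    MDifferentiableAt (𝓡 2) ((𝓡 2).prod 𝓘(ℝ, EuclideanSpace ℝ (Fin 2)))
      (fun y ↦ TotalSpace.mk' (EuclideanSpace ℝ (Fin 2))
        (E := (TangentSpace (𝓡 2) : M → Type _)) y (V y)) x :=
  V.mdifferentiableAt

/-- Every tangent vector extends to a global smooth vector field. -/
lemma exists_eventuallyEq_extend [T2Space M] {x : M} (v : TangentSpace (𝓡 2) x) :
    ∃ V : SmoothField M, ∀ᶠ y in 𝓝 x, V y = extend (EuclideanSpace ℝ (Fin 2)) v y := by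
  obtain ⟨s, hs, hV⟩ := exists_contMDiffOn_extend (k := ∞) (𝓡 2) (EuclideanSpace ℝ (Fin 2)) v
  obtain ⟨ψ, -, hψ⟩ := ((SmoothBumpFunction.nhds_basis_tsupport (I := 𝓡 2) x).mem_iff).1
    (interior_mem_nhds.2 hs)
  refine ⟨⟨fun y ↦ ψ y • extend (EuclideanSpace ℝ (Fin 2)) v y, ?_⟩, ?_⟩
  · exact ContMDiffOn.smul_section_of_tsupport ψ.contMDiff.contMDiffOn isOpen_interior hψ
      (hV.mono interior_subset)
  · filter_upwards [ψ.eventuallyEq_one] with y hy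
    change ψ y • extend (EuclideanSpace ℝ (Fin 2)) v y = extend (EuclideanSpace ℝ (Fin 2)) v y
    rw [hy, Pi.one_apply, one_smul]

lemma exists_apply_eq [T2Space M] {x : M} (v : TangentSpace (𝓡 2) x) :
    ∃ V : SmoothField M, V x = v := by
  obtain ⟨V, hV⟩ := exists_eventuallyEq_extend v
  exact ⟨V, by rw [hV.self_of_nhds, extend_apply_self]⟩

lemma contMDiff_along (U : SmoothField M) (f : SmoothFn M) :
    ContMDiff (𝓡 2) 𝓘(ℝ, ℝ) ∞ (along (fun x ↦ U x) f) := by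
  have h1 : ContMDiff (𝓡 2).tangent 𝓘(ℝ, ℝ).tangent ∞ (tangentMap (𝓡 2) 𝓘(ℝ, ℝ) f) :=
    f.contMDiff.contMDiff_tangentMap (by simp)
  exact (contMDiff_snd_tangentBundle_modelSpace ℝ 𝓘(ℝ, ℝ)).comp (h1.comp U.contMDiff)

/-- The derivative of a smooth function along a smooth vector field. -/
def deriv (U : SmoothField M) (f : SmoothFn M) : SmoothFn M :=
  ⟨along (fun x ↦ U x) f, contMDiff_along U f⟩

lemma deriv_add (U : SmoothField M) (f g : SmoothFn M) :
    deriv U (f + g) = deriv U f + deriv U g := by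
  ext x
  change mvfderiv (𝓡 2) (f + g : M → ℝ) x (U x) = deriv U f x + deriv U g x
  rw [mvfderiv_add (f.mdiffAt x) (g.mdiffAt x)]
  rfl

lemma deriv_mul (U : SmoothField M) (f g : SmoothFn M) :
    deriv U (f * g) = f * deriv U g + g * deriv U f := by
  ext x
  change mvfderiv (𝓡 2) (f * g : M → ℝ) x (U x) = f x * deriv U g x + g x * deriv U f x
  rw [mvfderiv_mul (f.mdiffAt x) (g.mdiffAt x)]
  rfl

lemma deriv_const_smul (U : SmoothField M) (a : ℝ) (f : SmoothFn M) :
    deriv U (a • f) = a • deriv U f := by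
  ext x
  change mvfderiv (𝓡 2) ((fun _ : M ↦ a) * (f : M → ℝ)) x (U x) = a * deriv U f x
  rw [mvfderiv_mul mdifferentiableAt_const (f.mdiffAt x), mvfderiv_const, smul_zero, add_zero]
  rfl

/-- Vector fields act on functions by derivations. -/
def derivation : SmoothField M →ₗ[SmoothFn M] Derivation ℝ (SmoothFn M) (SmoothFn M) where
  toFun U := Derivation.mk' ⟨⟨deriv U, deriv_add U⟩, deriv_const_smul U⟩ (deriv_mul U)
  map_add' U V := by
    refine Derivation.ext fun f ↦ ContMDiffMap.ext fun x ↦ ?_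
    exact map_add (mvfderiv (𝓡 2) f x) (U x) (V x)
  map_smul' g U := by
    refine Derivation.ext fun f ↦ ContMDiffMap.ext fun x ↦ ?_
    exact map_smul (mvfderiv (𝓡 2) f x) (g x) (U x)

/-- The Lie bracket of smooth vector fields. -/
def bracket (U V : SmoothField M) : SmoothField M :=
  ⟨VectorField.mlieBracket (𝓡 2) (fun x ↦ U x) (fun x ↦ V x),
    haveI : IsManifold (𝓡 2) (((⊤ : ℕ∞) : WithTop ℕ∞) + 1) M := by simpa
    ContDiff.mlieBracket_vectorField (m := ⊤) (n := ⊤) U.contMDiff V.contMDiff (by simp)⟩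

lemma bracket_add_right (U V W : SmoothField M) :
    bracket U (V + W) = bracket U V + bracket U W := by
  ext x
  exact VectorField.mlieBracket_add_right (V.mdiffAt x) (W.mdiffAt x)

lemma bracket_smul_right (f : SmoothFn M) (U V : SmoothField M) :
    bracket U (f • V) = derivation U f • V + f • bracket U V := by
  ext x
  exact VectorField.mlieBracket_smul_right (f.mdiffAt x) (V.mdiffAt x)

lemma jacobi (U V W : SmoothField M) :
    bracket U (bracket V W) = bracket (bracket U V) W + bracket V (bracket U W) := by
  ext x
  have h2 : minSmoothness ℝ 2 ≤ ((⊤ : ℕ∞) : WithTop ℕ∞) := by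
    rw [minSmoothness_of_isRCLikeNormedField]; exact WithTop.coe_le_coe.2 (le_top (a := (2 : ℕ∞)))
  exact VectorField.leibniz_identity_mlieBracket_apply (U.contMDiff.contMDiffAt.of_le h2)
    (V.contMDiff.contMDiffAt.of_le h2) (W.contMDiff.contMDiffAt.of_le h2)

lemma derivation_bracket [T2Space M] (U V : SmoothField M) (f : SmoothFn M) :
    derivation U (derivation V f) - derivation V (derivation U f) = derivation (bracket U V) f := by
  ext x
  obtain ⟨W, hW⟩ := exists_apply_eq (tangentBasis x 0)
  have h1 := jacobi U V (f • W)
  have h2 := jacobi U V W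
  simp only [bracket_smul_right, bracket_add_right] at h1
  have h3 : (derivation U (derivation V f) - derivation V (derivation U f)
      - derivation (bracket U V) f) • W = 0 := by
    linear_combination (norm := module) h1 - f • h2
  have h4 := congrArg (fun Z : SmoothField M ↦ Z x) h3
  simp only [smul_apply, hW] at h4
  have h5 := (smul_eq_zero.1 h4).resolve_right ((tangentBasis x).ne_zero 0)
  exact sub_eq_zero.1 h5

end SmoothField

end Fields

end

section

open SmoothField

variable {M : Type*} [TopologicalSpace M] [ChartedSpace (EuclideanSpace ℝ (Fin 2)) M]

lemma eq_sum_tangentBasis (x : M) (u : TangentSpace (𝓡 2) x) :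
    u = (tangentBasis x).repr u 0 • tangentBasis x 0
      + (tangentBasis x).repr u 1 • tangentBasis x 1 := by
  conv_lhs => rw [← (tangentBasis x).sum_repr u, Fin.sum_univ_two]

variable [IsManifold (𝓡 2) ∞ M]

lemma SmoothField.exists_frame [T2Space M] (x : M) :
    ∃ E F : SmoothField M, E x = tangentBasis x 0 ∧ F x = tangentBasis x 1 :=
  let ⟨E, hE⟩ := SmoothField.exists_apply_eq (tangentBasis x 0)
  let ⟨F, hF⟩ := SmoothField.exists_apply_eq (tangentBasis x 1)
  ⟨E, F, hE, hF⟩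

namespace VolumeForm

variable (ε : VolumeForm M)

lemma form_swap (x : M) (u v : TangentSpace (𝓡 2) x) : ε.form x u v = -ε.form x v u := by
  have h := ε.alternating x (u + v)
  simp only [map_add, _root_.add_apply, ε.alternating] at h
  linear_combination h

lemma form_eq (x : M) (u v : TangentSpace (𝓡 2) x) :
    ε.form x u v = ((tangentBasis x).repr u 0 * (tangentBasis x).repr v 1
      - (tangentBasis x).repr u 1 * (tangentBasis x).repr v 0) * ε.comp x := by
  conv_lhs => rw [eq_sum_tangentBasis x u, eq_sum_tangentBasis x v]
  simp only [map_add, map_smul, _root_.add_apply, _root_.smul_apply, ε.alternating,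
    ε.form_swap x (tangentBasis x 1) (tangentBasis x 0), smul_eq_mul, comp]
  ring

lemma comp_ne_zero (x : M) : ε.comp x ≠ 0 := by
  intro h
  refine ε.ne_zero x ?_
  ext u v
  rw [ε.form_eq, h, mul_zero]
  rfl

lemma form_expand (x : M) (u v z : TangentSpace (𝓡 2) x) :
    ε.form x u v • z = ε.form x z v • u + ε.form x u z • v := by
  apply (tangentBasis x).repr.injective
  ext i
  simp only [map_add, map_smul, Finsupp.add_apply, Finsupp.smul_apply, smul_eq_mul, ε.form_eq]
  fin_cases i <;> simp <;> ring

/-- The volume form as a bilinear form on smooth vector fields. -/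
def vol : SmoothField M →ₗ[SmoothFn M] SmoothField M →ₗ[SmoothFn M] SmoothFn M :=
  LinearMap.mk₂ _ (fun U V ↦ ⟨fun x ↦ ε.form x (U x) (V x), by
      have h := ContMDiff.clm_bundle_apply₂ (E₃ := fun _ : M ↦ ℝ) (F₃ := ℝ) ε.smooth U.contMDiff
        V.contMDiff
      intro x
      have h' := h x
      rw [contMDiffAt_totalSpace] at h'
      exact h'.2⟩)
    (fun U U' V ↦ by ext x; simp [SmoothField.add_apply]; rfl)
    (fun f U V ↦ by ext x; simp [SmoothField.smul_apply]; rfl)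
    (fun U V V' ↦ by ext x; simp [SmoothField.add_apply]; rfl)
    (fun f U V ↦ by ext x; simp [SmoothField.smul_apply]; rfl)

lemma vol_apply (U V : SmoothField M) (x : M) : ε.vol U V x = ε.form x (U x) (V x) := rfl

lemma vol_self (U : SmoothField M) : ε.vol U U = 0 := by
  ext x; exact ε.alternating x (U x)

lemma vol_expand (U V Z : SmoothField M) :
    ε.vol U V • Z = ε.vol Z V • U + ε.vol U Z • V := by
  ext x; exact ε.form_expand x (U x) (V x) (Z x)

lemma vol_swap (U V : SmoothField M) : ε.vol U V = -ε.vol V U := by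
  ext x; exact ε.form_swap x (U x) (V x)

lemma _root_.LinearMap.swap_of_self {R X : Type*} [CommRing R] [AddCommGroup X] [Module R X]
    {S : X →ₗ[R] X →ₗ[R] R} (hself : ∀ U, S U U = 0) (U V : X) : S U V = -S V U := by
  have h := hself (U + V)
  simp only [map_add, LinearMap.add_apply, hself] at h
  linear_combination h

/-- Any two alternating forms on a surface are proportional. -/
lemma alternating_proportional {S : SmoothField M →ₗ[SmoothFn M] SmoothField M →ₗ[SmoothFn M]
    SmoothFn M} (hself : ∀ U, S U U = 0) {x : M} {E F : SmoothField M} (hx : ε.vol E F x ≠ 0)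
    (U V : SmoothField M) : ε.vol E F x * S U V x = ε.vol U V x * S E F x := by
  have key : ∀ S : SmoothField M →ₗ[SmoothFn M] SmoothField M →ₗ[SmoothFn M] SmoothFn M,
      (∀ U, S U U = 0) → ε.vol E F * (ε.vol E F * S U V)
        = (ε.vol U F * ε.vol E V - ε.vol E U * ε.vol V F) * S E F := by
    intro S hS
    have h1 : S (ε.vol E F • U) (ε.vol E F • V) = ε.vol E F * (ε.vol E F * S U V) := by
      simp
    rw [← h1, ε.vol_expand E F U, ε.vol_expand E F V]
    simp only [map_add, map_smul, LinearMap.add_apply, LinearMap.smul_apply, smul_eq_mul, hS,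
      LinearMap.swap_of_self hS F E]
    ring
  have h1 := key S hself
  have h2 := key ε.vol ε.vol_self
  have h3 : ε.vol E F * (ε.vol E F * (ε.vol E F * S U V))
      = ε.vol E F * (ε.vol E F * (ε.vol U V * S E F)) := by
    linear_combination ε.vol E F * h1 - S E F * h2
  have h4 := congrArg (fun k : SmoothFn M ↦ k x) h3
  exact mul_left_cancel₀ hx (mul_left_cancel₀ hx h4)

variable [T2Space M]

lemma exists_vol_ne_zero (x : M) : ∃ E F : SmoothField M, ε.vol E F x ≠ 0 := by
  obtain ⟨E, F, hE, hF⟩ := exists_frame x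
  refine ⟨E, F, ?_⟩
  rw [vol_apply, hE, hF]
  exact ε.comp_ne_zero x

lemma eq_of_mul_vol {f g : SmoothFn M} (h : ∀ E F, f * ε.vol E F = g * ε.vol E F) : f = g := by
  ext x
  obtain ⟨E, F, hx⟩ := ε.exists_vol_ne_zero x
  exact mul_right_cancel₀ hx (congrArg (fun k : SmoothFn M ↦ k x) (h E F))

lemma eq_of_vol_left {U V : SmoothField M} (h : ∀ Z, ε.vol U Z = ε.vol V Z) : U = V := by
  ext x
  obtain ⟨E, F, hx⟩ := ε.exists_vol_ne_zero x
  have h1 := ε.vol_expand E F U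
  rw [h F, ε.vol_swap E U, h E, ← ε.vol_swap E V, ← ε.vol_expand E F V] at h1
  exact smul_right_injective _ hx (congrArg (fun Z : SmoothField M ↦ Z x) h1)

lemma contMDiff_of_mul_vol {f : M → ℝ}
    (h : ∀ E F, ∃ g : SmoothFn M, ∀ x, f x * ε.vol E F x = g x) :
    ContMDiff (𝓡 2) 𝓘(ℝ, ℝ) ∞ f := by
  intro x
  obtain ⟨E, F, hx⟩ := ε.exists_vol_ne_zero x
  obtain ⟨g, hg⟩ := h E F
  have h1 : ContMDiffAt (𝓡 2) 𝓘(ℝ, ℝ) ∞ (fun y ↦ g y / ε.vol E F y) x :=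
    g.contMDiff.contMDiffAt.div₀ (ε.vol E F).contMDiff.contMDiffAt hx
  refine h1.congr_of_eventuallyEq ?_
  filter_upwards [(ε.vol E F).contMDiff.continuous.continuousAt.eventually_ne hx] with y hy
  rw [← hg, mul_div_cancel_right₀ _ hy]

lemma contMDiff_of_vol_left {U : VectorField M}
    (h : ∀ Z : SmoothField M, ∃ g : SmoothFn M, ∀ x, ε.form x (U x) (Z x) = g x) :
    ContMDiff (𝓡 2) ((𝓡 2).prod 𝓘(ℝ, EuclideanSpace ℝ (Fin 2))) ∞
      (fun x ↦ TotalSpace.mk' (EuclideanSpace ℝ (Fin 2))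
        (E := (TangentSpace (𝓡 2) : M → Type _)) x (U x)) := by
  intro x
  obtain ⟨E, F, hx⟩ := ε.exists_vol_ne_zero x
  obtain ⟨a, ha⟩ := h F
  obtain ⟨b, hb⟩ := h E
  have hi : ContMDiffAt (𝓡 2) 𝓘(ℝ, ℝ) ∞ (fun y ↦ (ε.vol E F y)⁻¹) x :=
    (ε.vol E F).contMDiff.contMDiffAt.inv₀ hx
  have h1 := hi.smul_section (a • E - b • F).contMDiff.contMDiffAt
  refine h1.congr_of_eventuallyEq ?_
  filter_upwards [(ε.vol E F).contMDiff.continuous.continuousAt.eventually_ne hx] with y hy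
  have h2 := ε.form_expand y (E y) (F y) (U y)
  rw [ha, ε.form_swap y (E y) (U y), hb] at h2
  change TotalSpace.mk' _ y (U y) = TotalSpace.mk' _ y ((ε.vol E F y)⁻¹ • (a y • E y - b y • F y))
  rw [sub_eq_add_neg, ← neg_smul, ← h2, vol_apply, smul_smul,
    inv_mul_cancel₀ (vol_apply ε E F y ▸ hy), one_smul]

/-- An operation on vector fields that is additive and homogeneous over smooth functions
depends only on the value at the point. -/
lemma tensorial (ε : VolumeForm M) {G : Type*} [AddCommGroup G] [Module ℝ G] {x : M}
    {Φ : SmoothField M → G}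
    (hadd : ∀ U V, Φ (U + V) = Φ U + Φ V) (hsmul : ∀ (f : SmoothFn M) U, Φ (f • U) = f x • Φ U)
    {U V : SmoothField M} (h : U x = V x) : Φ U = Φ V := by
  have h0 : Φ (U - V) = 0 := by
    obtain ⟨E, F, hx⟩ := ε.exists_vol_ne_zero x
    have h1 := congrArg Φ (ε.vol_expand E F (U - V))
    have h2 : (U - V) x = 0 := by rw [SmoothField.sub_apply, h, sub_self]
    rw [hadd, hsmul, hsmul, hsmul, ε.vol_apply (U - V), ε.vol_apply E (U - V), h2, map_zero,
      map_zero, _root_.zero_apply, zero_smul, zero_smul, add_zero] at h1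
    exact (smul_eq_zero.1 h1).resolve_left hx
  have h1 := hadd (U - V) V
  rwa [sub_add_cancel, h0, zero_add] at h1

lemma eq_zero_of_vol_mul {S : SmoothField M →ₗ[SmoothFn M] SmoothField M →ₗ[SmoothFn M]
    SmoothFn M} (hself : ∀ U, S U U = 0) (h : ∀ U V, ε.vol U V * S U V = 0)
    (U V : SmoothField M) : S U V = 0 := by
  ext x
  obtain ⟨E, F, hx⟩ := ε.exists_vol_ne_zero x
  have h1 := ε.alternating_proportional hself hx U V
  have h2 : S E F x = 0 :=
    (mul_eq_zero.1 (congrArg (fun k : SmoothFn M ↦ k x) (h E F))).resolve_left hx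
  rw [h2, mul_zero] at h1
  exact (mul_eq_zero.1 h1).resolve_left hx

lemma trace_mul_vol {A : SmoothField M →ₗ[SmoothFn M] SmoothField M} {x : M}
    {a : TangentSpace (𝓡 2) x → TangentSpace (𝓡 2) x} (ha : ∀ U, a (U x) = A U x)
    (U V : SmoothField M) :
    trace x a * ε.vol U V x = ε.vol (A U) V x + ε.vol U (A V) x := by
  obtain ⟨E, F, hE, hF⟩ := exists_frame x
  have h0 : ε.vol E F x = ε.comp x := by rw [vol_apply, hE, hF, comp]
  have hx : ε.vol E F x ≠ 0 := h0 ▸ ε.comp_ne_zero x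
  have h1 := ε.alternating_proportional (S := ε.vol.comp A + ε.vol.compl₂ A) (fun U ↦ by
    simp [ε.vol_swap U (A U)]) hx U V
  have h2 : ε.vol (A E) F x + ε.vol E (A F) x = trace x a * ε.vol E F x := by
    rw [h0, vol_apply, vol_apply, ← ha, ← ha, hE, hF, form_eq, form_eq, trace,
      Fin.sum_univ_two]
    simp
    ring
  refine mul_left_cancel₀ hx ?_
  change _ * (ε.vol (A U) V x + ε.vol U (A V) x) = _ * (ε.vol (A E) F x + ε.vol E (A F) x) at h1
  rw [h1, h2]
  ring

lemma contract_mul_vol {S : SmoothField M →ₗ[SmoothFn M] SmoothField M →ₗ[SmoothFn M]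
    SmoothFn M} {x : M} {b : TangentSpace (𝓡 2) x → TangentSpace (𝓡 2) x → ℝ}
    (hb : ∀ U V, b (U x) (V x) = S U V x) (U V : SmoothField M) :
    ε.contract x b * ε.vol U V x = S U V x - S V U x := by
  obtain ⟨E, F, hE, hF⟩ := exists_frame x
  have h0 : ε.vol E F x = ε.comp x := by rw [vol_apply, hE, hF, comp]
  have hx : ε.vol E F x ≠ 0 := h0 ▸ ε.comp_ne_zero x
  have h1 := ε.alternating_proportional (S := S - S.flip) (fun U ↦ by simp) hx U V
  change _ * (S U V x - S V U x) = _ * (S E F x - S F E x) at h1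
  refine mul_left_cancel₀ hx ?_
  rw [h1, contract, ← hE, ← hF, hb, hb, ← h0]
  field_simp

lemma form_sharp {θ : SmoothField M →ₗ[SmoothFn M] SmoothFn M} {x : M}
    {t : TangentSpace (𝓡 2) x → ℝ} (ht : ∀ U, t (U x) = θ U x) (V : SmoothField M) :
    ε.form x (ε.sharp x t) (V x) = θ V x := by
  obtain ⟨E, F, hE, hF⟩ := exists_frame x
  have h0 : ε.vol E F x = ε.comp x := by rw [vol_apply, hE, hF, comp]
  have hx : ε.vol E F x ≠ 0 := h0 ▸ ε.comp_ne_zero x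
  have h1 := congrArg (fun Z ↦ θ Z x) (ε.vol_expand E F V)
  simp only [map_add, map_smul] at h1
  change ε.vol E F x * θ V x = ε.vol V F x * θ E x + ε.vol E V x * θ F x at h1
  rw [ε.vol_swap V F] at h1
  change _ = -ε.vol F V x * θ E x + _ at h1
  rw [sharp, ← hE, ← hF, ht, ht, ← h0]
  simp only [map_sub, map_smul, _root_.sub_apply, _root_.smul_apply, smul_eq_mul, ← vol_apply]
  field_simp
  linear_combination -h1

end VolumeForm

end

section

open SmoothField

variable {M : Type*} [TopologicalSpace M] [ChartedSpace (EuclideanSpace ℝ (Fin 2)) M]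
  [IsManifold (𝓡 2) ∞ M]

namespace IsSmoothTorsionFree

variable {D : AffineConnection M} (hD : IsSmoothTorsionFree D)

/-- The covariant derivative `∇_U V` of smooth vector fields. -/
def cov (U V : SmoothField M) : SmoothField M :=
  ⟨fun x ↦ D (fun y ↦ V y) x (U x), by
    have h : ContMDiffOn _ _ ∞ _ Set.univ :=
      hD.1.contMDiff.contMDiff (σ := fun y ↦ V y) V.contMDiff.contMDiffOn
    exact (contMDiffOn_univ.1 h).clm_bundle_apply U.contMDiff⟩

lemma cov_apply (U V : SmoothField M) (x : M) : hD.cov U V x = D (fun y ↦ V y) x (U x) := rfl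

lemma cov_add_left (U V Z : SmoothField M) : hD.cov (U + V) Z = hD.cov U Z + hD.cov V Z := by
  ext x; exact map_add (D (fun y ↦ Z y) x) (U x) (V x)

lemma cov_smul_left (f : SmoothFn M) (U Z : SmoothField M) :
    hD.cov (f • U) Z = f • hD.cov U Z := by
  ext x; exact map_smul (D (fun y ↦ Z y) x) (f x) (U x)

lemma cov_add_right (U V Z : SmoothField M) : hD.cov U (V + Z) = hD.cov U V + hD.cov U Z := by
  ext x
  exact congrArg (fun A ↦ A (U x))
    (D.isCovariantDerivativeOnUniv.add (V.mdiffAt x) (Z.mdiffAt x))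

lemma cov_smul_right (f : SmoothFn M) (U Z : SmoothField M) :
    hD.cov U (f • Z) = f • hD.cov U Z + derivation U f • Z := by
  ext x
  exact congrArg (fun A ↦ A (U x))
    (D.isCovariantDerivativeOnUniv.leibniz (Z.mdiffAt x) (f.mdiffAt x))

lemma bracket_eq (U V : SmoothField M) : bracket U V = hD.cov U V - hD.cov V U := by
  ext x
  exact ((CovariantDerivative.torsion_eq_zero_iff D).1 hD.2 (U.mdiffAt x) (V.mdiffAt x)).symm

lemma cov_sub_left (U V Z : SmoothField M) : hD.cov (U - V) Z = hD.cov U Z - hD.cov V Z := by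
  ext x; exact map_sub (D (fun y ↦ Z y) x) (U x) (V x)

/-- The curvature operator on smooth vector fields. -/
def curv (U V Z : SmoothField M) : SmoothField M :=
  hD.cov U (hD.cov V Z) - hD.cov V (hD.cov U Z) - (hD.cov (hD.cov U V) Z - hD.cov (hD.cov V U) Z)

lemma curv_swap (U V Z : SmoothField M) : hD.curv U V Z = -hD.curv V U Z := by
  simp only [curv]; abel

lemma curv_add_left (U U' V Z : SmoothField M) :
    hD.curv (U + U') V Z = hD.curv U V Z + hD.curv U' V Z := by
  simp only [curv, cov_add_left, cov_add_right]; abel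

lemma curv_smul_left (f : SmoothFn M) (U V Z : SmoothField M) :
    hD.curv (f • U) V Z = f • hD.curv U V Z := by
  simp only [curv, cov_smul_left, cov_smul_right, cov_add_left]; module

lemma curv_add_right (U V Z Z' : SmoothField M) :
    hD.curv U V (Z + Z') = hD.curv U V Z + hD.curv U V Z' := by
  simp only [curv, cov_add_right]; abel

lemma curv_add_middle (U V V' Z : SmoothField M) :
    hD.curv U (V + V') Z = hD.curv U V Z + hD.curv U V' Z := by
  rw [curv_swap, curv_add_left, curv_swap _ V, curv_swap _ V']; abel

lemma curv_smul_middle (f : SmoothFn M) (U V Z : SmoothField M) :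
    hD.curv U (f • V) Z = f • hD.curv U V Z := by
  rw [curv_swap, curv_smul_left, curv_swap _ V, smul_neg, neg_neg]

lemma _root_.ProjSurface.AffineConnection.congr (D : AffineConnection M) {V : SmoothField M}
    {Z : VectorField M} {x : M} (h : ∀ᶠ y in 𝓝 x, V y = Z y) : D (fun y ↦ V y) x = D Z x := by
  refine D.isCovariantDerivativeOnUniv.congr_of_eventuallyEq (V.mdiffAt x) ?_ Filter.univ_mem h
  refine (V.mdiffAt x).congr_of_eventuallyEq ?_
  filter_upwards [h] with y hy
  rw [hy]

variable [T2Space M]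

lemma derivation_comm (U V : SmoothField M) (f : SmoothFn M) :
    derivation U (derivation V f) - derivation V (derivation U f)
      = derivation (hD.cov U V) f - derivation (hD.cov V U) f := by
  rw [derivation_bracket, hD.bracket_eq, map_sub]; rfl

lemma curv_smul_right (f : SmoothFn M) (U V Z : SmoothField M) :
    hD.curv U V (f • Z) = f • hD.curv U V Z := by
  have h := congrArg (· • Z) (hD.derivation_comm U V f)
  simp only [sub_smul] at h
  simp only [curv, cov_add_right, cov_smul_right]
  linear_combination (norm := module) h

lemma curv_congr (ε : VolumeForm M) {U U' V V' Z Z' : SmoothField M} {x : M} (hU : U x = U' x)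
    (hV : V x = V' x) (hZ : Z x = Z' x) : hD.curv U V Z x = hD.curv U' V' Z' x := by
  trans hD.curv U' V Z x
  · exact ε.tensorial (Φ := fun U ↦ hD.curv U V Z x)
      (fun _ _ ↦ by rw [curv_add_left]; rfl) (fun _ _ ↦ by rw [curv_smul_left]; rfl) hU
  trans hD.curv U' V' Z x
  · exact ε.tensorial (Φ := fun V ↦ hD.curv U' V Z x)
      (fun _ _ ↦ by rw [curv_add_middle]; rfl) (fun _ _ ↦ by rw [curv_smul_middle]; rfl) hV
  · exact ε.tensorial (Φ := fun Z ↦ hD.curv U' V' Z x)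
      (fun _ _ ↦ by rw [curv_add_right]; rfl) (fun _ _ ↦ by rw [curv_smul_right]; rfl) hZ

lemma curvature_apply (ε : VolumeForm M) (U V Z : SmoothField M) (x : M) :
    curvature D x (U x) (V x) (Z x) = hD.curv U V Z x := by
  obtain ⟨U', hU⟩ := exists_eventuallyEq_extend (U x)
  obtain ⟨V', hV⟩ := exists_eventuallyEq_extend (V x)
  obtain ⟨Z', hZ⟩ := exists_eventuallyEq_extend (Z x)
  have hU' : U' x = U x := by rw [hU.self_of_nhds, extend_apply_self]
  have hV' : V' x = V x := by rw [hV.self_of_nhds, extend_apply_self]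
  have hZ' : Z' x = Z x := by rw [hZ.self_of_nhds, extend_apply_self]
  rw [← hD.curv_congr ε hU' hV' hZ']
  have key : ∀ {A B : SmoothField M} {a : VectorField M}, (∀ᶠ y in 𝓝 x, A y = a y) →
      D (fun y ↦ D (extend (EuclideanSpace ℝ (Fin 2)) (Z x)) y (a y)) x
        = D (fun y ↦ hD.cov A Z' y) x := by
    intro A B a hA
    symm
    refine AffineConnection.congr D ?_
    filter_upwards [hA, hZ.eventually_nhds] with y hy hy'
    rw [cov_apply, hy, AffineConnection.congr D hy']
  rw [curvature, curvatureField, key (B := U') hU, key (B := U') hV, ← AffineConnection.congr D hZ]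
  rw [extend_apply_self, extend_apply_self, ← hU', ← hV']
  have hb : VectorField.mlieBracket (𝓡 2) (extend (EuclideanSpace ℝ (Fin 2)) (U x))
      (extend (EuclideanSpace ℝ (Fin 2)) (V x)) x = bracket U' V' x :=
    Filter.EventuallyEq.mlieBracket_vectorField_eq (hU.mono fun _ h ↦ h.symm)
      (hV.mono fun _ h ↦ h.symm)
  rw [hU', hV', hb, hD.bracket_eq, ← hU', ← hV']
  simp only [curv, ← cov_sub_left]
  rfl

end IsSmoothTorsionFree

end

section

open SmoothField

variable {M : Type*} [TopologicalSpace M] [ChartedSpace (EuclideanSpace ℝ (Fin 2)) M]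

lemma mvfderiv_congr {f g : M → ℝ} {x : M} (h : f =ᶠ[𝓝 x] g) (u : TangentSpace (𝓡 2) x) :
    mvfderiv (𝓡 2) f x u = mvfderiv (𝓡 2) g x u :=
  DFunLike.congr_fun h.mfderiv_eq u

variable [IsManifold (𝓡 2) ∞ M]

namespace IsSmoothTorsionFree

variable {D : AffineConnection M} (hD : IsSmoothTorsionFree D)

/-- The covariant derivative of a vector field as a field of endomorphisms. -/
def covEnd (V : SmoothField M) : SmoothField M →ₗ[SmoothFn M] SmoothField M where
  toFun U := hD.cov U V
  map_add' U U' := hD.cov_add_left U U' V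
  map_smul' f U := hD.cov_smul_left f U V

/-- The covariant derivative of a one-form. -/
def covForm (θ : SmoothField M →ₗ[SmoothFn M] SmoothFn M) :
    SmoothField M →ₗ[SmoothFn M] SmoothField M →ₗ[SmoothFn M] SmoothFn M :=
  LinearMap.mk₂ _ (fun U V ↦ derivation U (θ V) - θ (hD.cov U V))
    (fun U U' V ↦ by simp only [map_add, cov_add_left, Derivation.add_apply]; ring)
    (fun f U V ↦ by
      simp only [map_smul, cov_smul_left, Derivation.smul_apply, smul_eq_mul]; ring)
    (fun U V V' ↦ by simp only [map_add, cov_add_right]; ring)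
    (fun f U V ↦ by
      simp only [map_smul, map_add, cov_smul_right, Derivation.leibniz, smul_eq_mul]; ring)

lemma covForm_apply (θ : SmoothField M →ₗ[SmoothFn M] SmoothFn M) (U V : SmoothField M) :
    hD.covForm θ U V = derivation U (θ V) - θ (hD.cov U V) := rfl

/-- The covariant derivative of a covariant two-tensor. -/
def covTwo (T : SmoothField M →ₗ[SmoothFn M] SmoothField M →ₗ[SmoothFn M] SmoothFn M)
    (U V Z : SmoothField M) : SmoothFn M :=
  derivation U (T V Z) - T (hD.cov U V) Z - T V (hD.cov U Z)

section CovTwo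

variable (T : SmoothField M →ₗ[SmoothFn M] SmoothField M →ₗ[SmoothFn M] SmoothFn M)

lemma covTwo_add_left (U U' V Z : SmoothField M) :
    hD.covTwo T (U + U') V Z = hD.covTwo T U V Z + hD.covTwo T U' V Z := by
  simp only [covTwo, map_add, cov_add_left, Derivation.add_apply, LinearMap.add_apply]; ring

lemma covTwo_smul_left (f : SmoothFn M) (U V Z : SmoothField M) :
    hD.covTwo T (f • U) V Z = f * hD.covTwo T U V Z := by
  simp only [covTwo, map_smul, cov_smul_left, Derivation.smul_apply, LinearMap.smul_apply,
    smul_eq_mul]; ring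

lemma covTwo_add_middle (U V V' Z : SmoothField M) :
    hD.covTwo T U (V + V') Z = hD.covTwo T U V Z + hD.covTwo T U V' Z := by
  simp only [covTwo, map_add, cov_add_right, LinearMap.add_apply]; ring

lemma covTwo_smul_middle (f : SmoothFn M) (U V Z : SmoothField M) :
    hD.covTwo T U (f • V) Z = f * hD.covTwo T U V Z := by
  simp only [covTwo, map_smul, map_add, cov_smul_right, Derivation.leibniz, LinearMap.smul_apply,
    LinearMap.add_apply, smul_eq_mul]; ring

lemma covTwo_add_right (U V Z Z' : SmoothField M) :
    hD.covTwo T U V (Z + Z') = hD.covTwo T U V Z + hD.covTwo T U V Z' := by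
  simp only [covTwo, map_add, cov_add_right]; ring

lemma covTwo_smul_right (f : SmoothFn M) (U V Z : SmoothField M) :
    hD.covTwo T U V (f • Z) = f * hD.covTwo T U V Z := by
  simp only [covTwo, map_smul, map_add, cov_smul_right, Derivation.leibniz, smul_eq_mul]; ring

/-- The skew part of the covariant derivative of a two-tensor, contracted in the last slot. -/
def skewCovTwo (Z : SmoothField M) :
    SmoothField M →ₗ[SmoothFn M] SmoothField M →ₗ[SmoothFn M] SmoothFn M :=
  LinearMap.mk₂ _ (fun U V ↦ hD.covTwo T U V Z - hD.covTwo T V U Z)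
    (fun U U' V ↦ by rw [covTwo_add_left, covTwo_add_middle]; ring)
    (fun f U V ↦ by rw [covTwo_smul_left, covTwo_smul_middle, smul_eq_mul]; ring)
    (fun U V V' ↦ by rw [covTwo_add_left, covTwo_add_middle]; ring)
    (fun f U V ↦ by rw [covTwo_smul_left, covTwo_smul_middle, smul_eq_mul]; ring)

lemma skewCovTwo_apply (U V Z : SmoothField M) :
    hD.skewCovTwo T Z U V = hD.covTwo T U V Z - hD.covTwo T V U Z := rfl

end CovTwo

lemma curv_self (U Z : SmoothField M) : hD.curv U U Z = 0 := by
  simp only [curv]; abel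

variable [T2Space M]

lemma covBilin_apply (ε : VolumeForm M)
    {t : ∀ x : M, TangentSpace (𝓡 2) x → TangentSpace (𝓡 2) x → ℝ}
    {T : SmoothField M →ₗ[SmoothFn M] SmoothField M →ₗ[SmoothFn M] SmoothFn M}
    (ht : ∀ x U V, t x (U x) (V x) = T U V x) (U V Z : SmoothField M) (x : M) :
    covBilin D t x (U x) (V x) (Z x) = hD.covTwo T U V Z x := by
  obtain ⟨V', hV⟩ := exists_eventuallyEq_extend (V x)
  obtain ⟨Z', hZ⟩ := exists_eventuallyEq_extend (Z x)
  have hV' : V' x = V x := by rw [hV.self_of_nhds, extend_apply_self]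
  have hZ' : Z' x = Z x := by rw [hZ.self_of_nhds, extend_apply_self]
  trans hD.covTwo T U V' Z' x
  · have h1 : (fun y ↦ t y (extend (EuclideanSpace ℝ (Fin 2)) (V x) y)
        (extend (EuclideanSpace ℝ (Fin 2)) (Z x) y)) =ᶠ[𝓝 x] T V' Z' := by
      filter_upwards [hV, hZ] with y h h'
      rw [← h, ← h', ht]
    have h2 : mvfderiv (𝓡 2) (fun y ↦ t y (extend (EuclideanSpace ℝ (Fin 2)) (V x) y)
        (extend (EuclideanSpace ℝ (Fin 2)) (Z x) y)) x (U x)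
        = derivation U (T V' Z') x :=
      mvfderiv_congr h1 (U x)
    rw [covBilin, h2, ← AffineConnection.congr D hV, ← AffineConnection.congr D hZ, ← cov_apply hD,
      ← cov_apply hD, ← hV', ← hZ', ht, ht]
    rfl
  trans hD.covTwo T U V Z' x
  · exact ε.tensorial (Φ := fun V ↦ hD.covTwo T U V Z' x)
      (fun _ _ ↦ by rw [covTwo_add_middle]; rfl) (fun _ _ ↦ by rw [covTwo_smul_middle]; rfl) hV'
  · exact ε.tensorial (Φ := fun Z ↦ hD.covTwo T U V Z x)
      (fun _ _ ↦ by rw [covTwo_add_right]; rfl) (fun _ _ ↦ by rw [covTwo_smul_right]; rfl) hZ'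

lemma covOneForm_apply (ε : VolumeForm M) {t : ∀ x : M, TangentSpace (𝓡 2) x → ℝ}
    {θ : SmoothField M →ₗ[SmoothFn M] SmoothFn M} (ht : ∀ x U, t x (U x) = θ U x)
    (U V : SmoothField M) (x : M) :
    covOneForm D t x (U x) (V x) = hD.covForm θ U V x := by
  obtain ⟨V', hV⟩ := exists_eventuallyEq_extend (V x)
  have hV' : V' x = V x := by rw [hV.self_of_nhds, extend_apply_self]
  trans hD.covForm θ U V' x
  · have h1 : (fun y ↦ t y (extend (EuclideanSpace ℝ (Fin 2)) (V x) y)) =ᶠ[𝓝 x] θ V' := by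
      filter_upwards [hV] with y h
      rw [← h, ht]
    have h2 : mvfderiv (𝓡 2) (fun y ↦ t y (extend (EuclideanSpace ℝ (Fin 2)) (V x) y)) x (U x)
        = derivation U (θ V') x :=
      mvfderiv_congr h1 (U x)
    rw [covOneForm, h2, ← AffineConnection.congr D hV, ← cov_apply hD, ht]
    rfl
  · exact ε.tensorial (Φ := fun V ↦ hD.covForm θ U V x)
      (fun _ _ ↦ by rw [map_add]; rfl) (fun _ _ ↦ by rw [map_smul]; rfl) hV'

/-- The curvature `U ↦ R(U, V) Z`. -/
def curvEnd (V Z : SmoothField M) : SmoothField M →ₗ[SmoothFn M] SmoothField M where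
  toFun U := hD.curv U V Z
  map_add' U U' := hD.curv_add_left U U' V Z
  map_smul' f U := hD.curv_smul_left f U V Z

lemma ricci_mul_vol_apply (ε : VolumeForm M) (V Z U U' : SmoothField M) (x : M) :
    ricci D x (V x) (Z x) * ε.vol U U' x
      = (ε.vol (hD.curv U V Z) U' + ε.vol U (hD.curv U' V Z)) x :=
  ε.trace_mul_vol (A := hD.curvEnd V Z) (fun U ↦ hD.curvature_apply ε U V Z x) U U'

/-- The Ricci tensor of smooth vector fields. -/
def ricciFn (ε : VolumeForm M) (V Z : SmoothField M) : SmoothFn M :=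
  ⟨fun x ↦ ricci D x (V x) (Z x),
    ε.contMDiff_of_mul_vol fun U U' ↦ ⟨_, fun x ↦ hD.ricci_mul_vol_apply ε V Z U U' x⟩⟩

lemma ricciFn_mul_vol (ε : VolumeForm M) (V Z U U' : SmoothField M) :
    hD.ricciFn ε V Z * ε.vol U U' = ε.vol (hD.curv U V Z) U' + ε.vol U (hD.curv U' V Z) :=
  ContMDiffMap.ext fun x ↦ hD.ricci_mul_vol_apply ε V Z U U' x

/-- The Ricci tensor as a bilinear form on smooth vector fields. -/
def ric (ε : VolumeForm M) : SmoothField M →ₗ[SmoothFn M] SmoothField M →ₗ[SmoothFn M] SmoothFn M :=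
  LinearMap.mk₂ _ (hD.ricciFn ε)
    (fun V V' Z ↦ ε.eq_of_mul_vol fun E F ↦ by
      simp only [add_mul, ricciFn_mul_vol, curv_add_middle, map_add, LinearMap.add_apply]; ring)
    (fun f V Z ↦ ε.eq_of_mul_vol fun E F ↦ by
      simp only [smul_eq_mul, mul_assoc, ricciFn_mul_vol, curv_smul_middle, map_smul,
        LinearMap.smul_apply, mul_add])
    (fun V Z Z' ↦ ε.eq_of_mul_vol fun E F ↦ by
      simp only [add_mul, ricciFn_mul_vol, curv_add_right, map_add, LinearMap.add_apply]; ring)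
    (fun f V Z ↦ ε.eq_of_mul_vol fun E F ↦ by
      simp only [smul_eq_mul, mul_assoc, ricciFn_mul_vol, curv_smul_right, map_smul,
        LinearMap.smul_apply, mul_add])

lemma ric_apply (ε : VolumeForm M) (V Z : SmoothField M) (x : M) :
    hD.ric ε V Z x = ricci D x (V x) (Z x) := rfl

lemma ric_mul_vol (ε : VolumeForm M) (V Z U U' : SmoothField M) :
    hD.ric ε V Z * ε.vol U U' = ε.vol (hD.curv U V Z) U' + ε.vol U (hD.curv U' V Z) :=
  hD.ricciFn_mul_vol ε V Z U U'

/-- In dimension two the Ricci tensor determines the curvature. -/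
lemma curv_eq (ε : VolumeForm M) (U V Z : SmoothField M) :
    hD.curv U V Z = hD.ric ε V Z • U - hD.ric ε U Z • V := by
  refine ε.eq_of_vol_left fun Z' ↦ ?_
  have h := ε.eq_zero_of_vol_mul (S := LinearMap.mk₂ _
      (fun U V ↦ ε.vol (hD.curv U V Z - (hD.ric ε V Z • U - hD.ric ε U Z • V)) Z')
      (fun U U' V ↦ by
        simp only [curv_add_left, map_add, map_sub, map_smul, LinearMap.add_apply,
          LinearMap.sub_apply, LinearMap.smul_apply, smul_eq_mul]; ring)
      (fun f U V ↦ by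
        simp only [curv_smul_left, map_sub, map_smul,
          LinearMap.sub_apply, LinearMap.smul_apply, smul_eq_mul]; ring)
      (fun U V V' ↦ by
        simp only [curv_add_middle, map_add, map_sub, map_smul, LinearMap.add_apply,
          LinearMap.sub_apply, LinearMap.smul_apply, smul_eq_mul]; ring)
      (fun f U V ↦ by
        simp only [curv_smul_middle, map_sub, map_smul,
          LinearMap.sub_apply, LinearMap.smul_apply, smul_eq_mul]; ring))
    (fun U ↦ by simp [curv_self]) (fun U V ↦ ?_) U V
  · rw [LinearMap.mk₂_apply, map_sub, LinearMap.sub_apply] at h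
    exact sub_eq_zero.1 h
  · have h1 := hD.ric_mul_vol ε V Z U V
    have h2 := hD.ric_mul_vol ε U Z U V
    rw [curv_self, map_zero, add_zero] at h1
    rw [curv_self, map_zero, LinearMap.zero_apply, zero_add, curv_swap, map_neg] at h2
    have h3 := congrArg (fun X ↦ ε.vol X Z') (ε.vol_expand U V (hD.curv U V Z))
    simp only [map_add, map_smul, LinearMap.add_apply, LinearMap.smul_apply, smul_eq_mul] at h3
    simp only [LinearMap.mk₂_apply, map_sub, map_smul, LinearMap.sub_apply,
      LinearMap.smul_apply, smul_eq_mul]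
    linear_combination h3 - h1 * ε.vol U Z' + h2 * ε.vol V Z'

/-- A connection preserving a volume form has symmetric Ricci tensor. -/
lemma ric_symm {ε : VolumeForm M} (hε : ∀ U V Z : SmoothField M,
    derivation U (ε.vol V Z) = ε.vol (hD.cov U V) Z + ε.vol V (hD.cov U Z))
    (U V : SmoothField M) : hD.ric ε V U = hD.ric ε U V := by
  have h := ε.eq_zero_of_vol_mul (S := hD.ric ε - (hD.ric ε).flip) (fun U ↦ by simp)
    (fun U V ↦ ?_) V U
  · exact sub_eq_zero.1 h
  · have h1 := hD.derivation_comm U V (ε.vol U V)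
    have h2 := congrArg (fun X ↦ ε.vol X V) (hD.curv_eq ε U V U)
    have h3 := congrArg (fun X ↦ ε.vol U X) (hD.curv_eq ε U V V)
    simp only [curv, map_sub, map_smul, LinearMap.sub_apply, LinearMap.smul_apply, smul_eq_mul,
      ε.vol_self] at h2 h3
    simp only [hε, map_add] at h1
    change ε.vol U V * (hD.ric ε U V - hD.ric ε V U) = 0
    linear_combination h2 + h3 - h1

lemma schouten_apply {ε : VolumeForm M} (hε : ∀ U V Z : SmoothField M,
    derivation U (ε.vol V Z) = ε.vol (hD.cov U V) Z + ε.vol V (hD.cov U Z))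
    (U V : SmoothField M) (x : M) : schouten D x (U x) (V x) = hD.ric ε U V x := by
  rw [schouten, ← hD.ric_apply ε, ← hD.ric_apply ε, hD.ric_symm hε U V]
  ring

end IsSmoothTorsionFree

end

section

open SmoothField

variable {M : Type*} [TopologicalSpace M] [ChartedSpace (EuclideanSpace ℝ (Fin 2)) M]

/-- Evaluation of smooth functions at a point. -/
def evalAt (x : M) : SmoothFn M →+* ℝ := ContMDiffMap.evalRingHom x

lemma evalAt_apply (x : M) (f : SmoothFn M) : evalAt x f = f x := rfl

lemma SmoothFn.two_mul_apply (f : SmoothFn M) (x : M) : (2 * f) x = 2 * f x := by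
  rw [← evalAt_apply, map_mul, map_ofNat, evalAt_apply]

namespace Scale

variable [IsManifold (𝓡 2) ∞ M] {p : ProjectiveStructure M} (s : Scale p)

lemma smooth : IsSmoothTorsionFree s.conn := ((p.mem_iff _ s.mem _).1 s.mem).1

lemma along_apply {X : VectorField M} {f : M → ℝ} (U : SmoothField M) (g : SmoothFn M)
    (hX : ∀ x, X x = U x) (hf : ∀ x, f x = evalAt x g) (x : M) :
    along X f x = evalAt x (derivation U g) := by
  rw [funext hX, funext hf]; rfl

variable [T2Space M]

lemma derivation_vol (U V Z : SmoothField M) :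
    derivation U (s.vol.vol V Z)
      = s.vol.vol (s.smooth.cov U V) Z + s.vol.vol V (s.smooth.cov U Z) := by
  ext x
  have h := s.smooth.covBilin_apply s.vol (t := fun y a b ↦ s.vol.form y a b) (T := s.vol.vol)
    (fun _ _ _ ↦ rfl) U V Z x
  rw [s.parallel] at h
  have h' : derivation U (s.vol.vol V Z) x - s.vol.vol (s.smooth.cov U V) Z x
      - s.vol.vol V (s.smooth.cov U Z) x = 0 := h.symm
  change _ = s.vol.vol (s.smooth.cov U V) Z x + s.vol.vol V (s.smooth.cov U Z) x
  linear_combination h'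

/-- The symmetric rho tensor on smooth vector fields. -/
def schoutenForm : SmoothField M →ₗ[SmoothFn M] SmoothField M →ₗ[SmoothFn M] SmoothFn M :=
  s.smooth.ric s.vol

lemma schouten_apply (U V : SmoothField M) (x : M) :
    schouten s.conn x (U x) (V x) = s.schoutenForm U V x :=
  s.smooth.schouten_apply s.derivation_vol U V x

lemma cotton_apply (U V Z : SmoothField M) (x : M) :
    cotton s.conn x (U x) (V x) (Z x) = s.smooth.skewCovTwo s.schoutenForm Z U V x := by
  have ht : ∀ x U V, schouten s.conn x (U x) (V x) = s.schoutenForm U V x :=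
    fun x U V ↦ s.schouten_apply U V x
  rw [cotton, s.smooth.covBilin_apply s.vol ht, s.smooth.covBilin_apply s.vol ht]
  rfl

lemma Ylow_mul_vol_apply (U V Z : SmoothField M) (x : M) :
    s.Ylow x (Z x) * s.vol.vol U V x = (2 * s.smooth.skewCovTwo s.schoutenForm Z U V) x := by
  have h := s.vol.contract_mul_vol (S := s.smooth.skewCovTwo s.schoutenForm Z)
    (b := fun v w ↦ cotton s.conn x v w (Z x)) (fun U V ↦ s.cotton_apply U V Z x) U V
  rw [Ylow, h]
  rw [SmoothFn.two_mul_apply]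
  simp only [IsSmoothTorsionFree.skewCovTwo_apply]
  change (s.smooth.covTwo s.schoutenForm U V Z x - s.smooth.covTwo s.schoutenForm V U Z x)
    - (s.smooth.covTwo s.schoutenForm V U Z x - s.smooth.covTwo s.schoutenForm U V Z x)
    = 2 * (s.smooth.covTwo s.schoutenForm U V Z x - s.smooth.covTwo s.schoutenForm V U Z x)
  ring

/-- The value of the one-form `Y_a` on a smooth vector field. -/
def YlowFn (Z : SmoothField M) : SmoothFn M :=
  ⟨fun x ↦ s.Ylow x (Z x),
    s.vol.contMDiff_of_mul_vol fun U V ↦ ⟨_, fun x ↦ s.Ylow_mul_vol_apply U V Z x⟩⟩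

lemma YlowFn_mul_vol (U V Z : SmoothField M) :
    s.YlowFn Z * s.vol.vol U V = 2 * s.smooth.skewCovTwo s.schoutenForm Z U V :=
  ContMDiffMap.ext fun x ↦ s.Ylow_mul_vol_apply U V Z x

/-- The one-form `Y_a` as a linear form on smooth vector fields. -/
def YlowForm : SmoothField M →ₗ[SmoothFn M] SmoothFn M where
  toFun := s.YlowFn
  map_add' Z Z' := s.vol.eq_of_mul_vol fun U V ↦ by
    simp only [add_mul, YlowFn_mul_vol, IsSmoothTorsionFree.skewCovTwo_apply,
      IsSmoothTorsionFree.covTwo_add_right]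
    ring
  map_smul' f Z := s.vol.eq_of_mul_vol fun U V ↦ by
    simp only [smul_eq_mul, RingHom.id_apply, mul_assoc, YlowFn_mul_vol,
      IsSmoothTorsionFree.skewCovTwo_apply, IsSmoothTorsionFree.covTwo_smul_right]
    ring

lemma form_Y (Z : SmoothField M) (x : M) : s.vol.form x (s.Y x) (Z x) = s.Ylow x (Z x) :=
  s.vol.form_sharp (θ := s.YlowForm) (fun _ ↦ rfl) Z

/-- The smooth vector field `Y^a`. -/
def Yfield : SmoothField M :=
  ⟨s.Y, s.vol.contMDiff_of_vol_left fun Z ↦ ⟨s.YlowFn Z, fun x ↦ s.form_Y Z x⟩⟩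

lemma vol_Yfield (Z : SmoothField M) : s.vol.vol s.Yfield Z = s.YlowFn Z :=
  ContMDiffMap.ext fun x ↦ s.form_Y Z x

lemma divergence_mul_vol_apply (Z U V : SmoothField M) (x : M) :
    divergence s.conn (fun y ↦ Z y) x * s.vol.vol U V x
      = (s.vol.vol (s.smooth.cov U Z) V + s.vol.vol U (s.smooth.cov V Z)) x :=
  s.vol.trace_mul_vol (A := s.smooth.covEnd Z) (fun _ ↦ rfl) U V

lemma phi_mul_vol_apply (U V : SmoothField M) (x : M) :
    s.phi x * s.vol.vol U V x
      = (2 * (s.vol.vol (s.smooth.cov U s.Yfield) V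
        + s.vol.vol U (s.smooth.cov V s.Yfield))) x := by
  rw [phi, mul_assoc, SmoothFn.two_mul_apply]
  exact congrArg (2 * ·) (s.divergence_mul_vol_apply s.Yfield U V x)

/-- The smooth function `φ`. -/
def phiFn : SmoothFn M :=
  ⟨s.phi, s.vol.contMDiff_of_mul_vol fun U V ↦ ⟨_, s.phi_mul_vol_apply U V⟩⟩

/-- The algebraic calculus of smooth functions and vector fields in a scale. -/
def calculus : SurfaceCalculus (derivation (M := M)) where
  D := s.smooth.cov
  D_add_left := s.smooth.cov_add_left
  D_smul_left := s.smooth.cov_smul_left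
  D_add_right := s.smooth.cov_add_right
  D_smul_right := s.smooth.cov_smul_right
  L_comm := s.smooth.derivation_comm
  ε := s.vol.vol
  ε_self := s.vol.vol_self
  ε_parallel := s.derivation_vol
  ε_expand := s.vol.vol_expand
  P := s.schoutenForm
  P_symm U V := s.smooth.ric_symm s.derivation_vol V U
  curv U V Z := s.smooth.curv_eq s.vol U V Z
  Y := s.Yfield
  cotton U V Z := by
    rw [s.vol_Yfield, mul_comm (s.vol.vol U V), s.YlowFn_mul_vol]; rfl
  φ := s.phiFn
  div_Y U V := (ContMDiffMap.ext fun x ↦ s.phi_mul_vol_apply U V x).symm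

lemma Y_apply (x : M) : s.Y x = s.calculus.Y x := rfl

lemma phi_apply (x : M) : s.phi x = evalAt x s.calculus.φ := rfl

lemma W_apply (x : M) : s.W x = s.calculus.W x := by
  change _ - (2 * s.phi x / 3) • s.Y x = _ - (2 / 3 * s.phi x) • s.Y x
  rw [mul_div_right_comm]
  rfl

lemma Ylow_apply (Z : SmoothField M) (x : M) :
    s.Ylow x (Z x) = s.calculus.ε s.calculus.Y Z x := (s.form_Y Z x).symm

lemma Wlow_apply (Z : SmoothField M) (x : M) :
    s.Wlow x (Z x) = s.calculus.ε s.calculus.W Z x := by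
  rw [Wlow, W_apply]; rfl

lemma rho_apply (x : M) : s.rho x = evalAt x s.calculus.ρ := by
  rw [rho, W_apply, Ylow_apply]; rfl

lemma along_Y_phi (x : M) :
    along s.Y s.phi x = evalAt x (derivation s.calculus.Y s.calculus.φ) := rfl

lemma ell_apply (x : M) : s.ell x = evalAt x s.calculus.ℓ := by
  have h3 := map_ofNat (evalAt x) 3
  rw [ell, Y_apply, schouten_apply, along_Y_phi, SurfaceCalculus.ℓ, map_sub, map_add, map_mul,
    map_ofNat]
  change _ = 5 / 12 * s.phi x ^ 2 + 3 * s.schoutenForm s.calculus.Y s.calculus.Y x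
    - 1 / 2 * evalAt x (derivation s.calculus.Y s.calculus.φ)
  ring

lemma dY_apply {A B : VectorField M} (U V : SmoothField M) (hA : ∀ x, A x = U x)
    (hB : ∀ x, B x = V x) (x : M) : s.dY A B x = s.calculus.dY (evalAt x) U V := by
  rw [dY, hA, hB, s.smooth.covOneForm_apply s.vol (θ := s.calculus.ε s.calculus.Y)
    (fun x U ↦ s.Ylow_apply U x), s.smooth.covForm_apply, s.calculus.ε_parallel]
  exact add_sub_cancel_right _ _

lemma dW_apply {A B : VectorField M} (U V : SmoothField M) (hA : ∀ x, A x = U x)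
    (hB : ∀ x, B x = V x) (x : M) : s.dW A B x = s.calculus.dW (evalAt x) U V := by
  rw [dW, hA, hB, s.smooth.covOneForm_apply s.vol (θ := s.calculus.ε s.calculus.W)
    (fun x U ↦ s.Wlow_apply U x), s.smooth.covForm_apply, s.calculus.ε_parallel]
  exact add_sub_cancel_right _ _

lemma divergence_W {x : M} (hx : s.rho x ≠ 0) :
    divergence s.conn s.W x = s.calculus.divW (evalAt x) := by
  rw [SurfaceCalculus.divW, ← rho_apply, eq_div_iff hx, funext s.W_apply]
  have h := s.divergence_mul_vol_apply s.calculus.W s.calculus.Y s.calculus.W x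
  rw [rho_apply]
  exact h

lemma polynomials_eq {x : M} (hx : s.rho x ≠ 0) :
    (s.a₁ x = s.calculus.a₁ (evalAt x) ∧ s.a₂ x = s.calculus.a₂ (evalAt x)
      ∧ s.a₃ x = s.calculus.a₃ (evalAt x)) ∧
    (s.b₁ x = s.calculus.b₁ (evalAt x) ∧ s.b₂ x = s.calculus.b₂ (evalAt x)
      ∧ s.b₃ x = s.calculus.b₃ (evalAt x)) ∧
    (s.c₁ x = s.calculus.c₁ (evalAt x) ∧ s.c₂ x = s.calculus.c₂ (evalAt x)
      ∧ s.c₃ x = s.calculus.c₃ (evalAt x)) := by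
  have hY := s.Y_apply
  have hW := s.W_apply
  refine ⟨⟨?_, ?_, ?_⟩, ⟨?_, ?_, ?_⟩, ⟨?_, ?_, ?_⟩⟩
  · rw [a₁, along_apply _ _ hY s.rho_apply, rho_apply, phi_apply]; rfl
  · rw [a₂, divergence_W s hx, along_apply _ _ hW s.rho_apply, rho_apply, ell_apply]; rfl
  · rw [a₃, divergence_W s hx, along_apply _ _ hW s.rho_apply, along_apply _ _ hY s.rho_apply,
      along_apply _ _ hW s.phi_apply, along_apply _ _ hY s.ell_apply, rho_apply, ell_apply,
      phi_apply]; rfl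
  · rw [b₁, dW_apply s _ _ hW hY, rho_apply, ell_apply]; rfl
  · rw [b₂, dW_apply s _ _ hW hW, rho_apply]; rfl
  · rw [b₃, dW_apply s _ _ hW hY, dW_apply s _ _ hW hW, along_apply _ _ hW s.ell_apply, rho_apply,
      ell_apply, phi_apply, hW, schouten_apply]; rfl
  · rw [c₁, dY_apply s _ _ hW hY, dW_apply s _ _ hY hY, rho_apply, phi_apply]; rfl
  · rw [c₂, dY_apply s _ _ hW hW, dW_apply s _ _ hY hW, rho_apply, ell_apply]; rfl
  · rw [c₃, dY_apply s _ _ hW hY, dY_apply s _ _ hW hW, dW_apply s _ _ hY hW,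
      dW_apply s _ _ hY hY, along_apply _ _ hW s.phi_apply, along_apply _ _ hY s.ell_apply,
      rho_apply, ell_apply, phi_apply, hW, hY, schouten_apply]; rfl

lemma isUnit_rho (hρ : ∀ x, s.rho x ≠ 0) : IsUnit s.calculus.ρ := by
  have h : ∀ x, s.calculus.ρ x ≠ 0 := fun x ↦ by
    rw [← evalAt_apply, ← rho_apply]; exact hρ x
  refine IsUnit.of_mul_eq_one ⟨fun x ↦ (s.calculus.ρ x)⁻¹, fun x ↦
    s.calculus.ρ.contMDiff.contMDiffAt.inv₀ (h x)⟩ ?_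
  ext x
  exact mul_inv_cancel₀ (h x)

end Scale

end

section

open SmoothField

variable {M : Type*} [TopologicalSpace M] [ChartedSpace (EuclideanSpace ℝ (Fin 2)) M]
  [IsManifold (𝓡 2) ∞ M]

/-- A smooth one-form as a linear form on smooth vector fields. -/
def OneForm.IsSmooth.linear {α : OneForm M} (hα : α.IsSmooth) :
    SmoothField M →ₗ[SmoothFn M] SmoothFn M where
  toFun U := ⟨fun x ↦ α x (U x), by
    have h := ContMDiff.clm_bundle_apply (E₂ := fun _ : M ↦ ℝ) (F₂ := ℝ) hα U.contMDiff
    intro x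
    have h' := h x
    rw [contMDiffAt_totalSpace] at h'
    exact h'.2⟩
  map_add' U V := by ext x; exact map_add (α x) (U x) (V x)
  map_smul' f U := by ext x; exact map_smul (α x) (f x) (U x)

namespace Scale

variable {p : ProjectiveStructure M} (s : Scale p)

lemma F_eq_contract (α : OneForm M) (x : M) :
    s.F α x = s.vol.contract x (covOneForm s.conn (fun y ↦ α y) x) := by
  rw [F, VolumeForm.contract, VolumeForm.contract]
  ring

variable [T2Space M]

lemma F_mul_vol_apply {α : OneForm M} (hα : α.IsSmooth) (U V : SmoothField M) (x : M) :
    s.F α x * s.vol.vol U V x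
      = (s.smooth.covForm hα.linear U V - s.smooth.covForm hα.linear V U) x := by
  rw [F_eq_contract]
  exact s.vol.contract_mul_vol (fun U V ↦ s.smooth.covOneForm_apply s.vol
    (t := fun y ↦ α y) (θ := hα.linear) (fun _ _ ↦ rfl) U V x) U V

/-- The smooth function `F`. -/
def Ffn {α : OneForm M} (hα : α.IsSmooth) : SmoothFn M :=
  ⟨s.F α, s.vol.contMDiff_of_mul_vol fun U V ↦ ⟨_, s.F_mul_vol_apply hα U V⟩⟩

lemma isEinsteinWeyl {α : OneForm M} (hα : α.IsSmooth) (h : IsPEWSolution s.conn α) :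
    s.calculus.IsEinsteinWeyl hα.linear (s.Ffn hα) := by
  intro U V
  ext x
  have h1 := h x (U x) (V x)
  have hc : ∀ U V : SmoothField M, covOneForm s.conn (fun y ↦ α y) x (U x) (V x)
      = s.smooth.covForm hα.linear U V x := fun U V ↦
    s.smooth.covOneForm_apply s.vol (θ := hα.linear) (fun _ _ ↦ rfl) U V x
  have hP : s.calculus.P V U = s.calculus.P U V := s.calculus.P_symm V U
  rw [hc, hc, schouten_apply, schouten_apply] at h1
  change _ + (s.calculus.P U V x + s.calculus.P V U x) / 2 = 0 at h1
  rw [hP] at h1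
  have h2 := s.F_mul_vol_apply hα U V x
  rw [SmoothFn.two_mul_apply]
  change 2 * (s.smooth.covForm hα.linear U V x + α x (U x) * α x (V x) + s.calculus.P U V x)
    = s.F α x * s.vol.vol U V x
  change _ = s.smooth.covForm hα.linear U V x - s.smooth.covForm hα.linear V U x at h2
  rw [h2]
  linear_combination 2 * h1

variable {s} in
lemma exists_isChange {s' : Scale p} {r : M → ℝ}
    (hr : ∀ x : M, s'.vol.form x = r x • s.vol.form x) :
    ∃ (Υ : SmoothField M →ₗ[SmoothFn M] SmoothFn M) (f g : SmoothFn M), (∀ x, f x = r x) ∧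
      SurfaceCalculus.IsChange s.calculus s'.calculus Υ f g := by
  obtain ⟨Υ, hΥ, hD⟩ := ((p.mem_iff _ s.mem _).1 s'.mem).2
  have hv : ∀ (U V : SmoothField M) x, r x * s.vol.vol U V x = s'.vol.vol U V x := by
    intro U V x
    rw [s'.vol.vol_apply, hr]
    rfl
  have h0 : ∀ x, r x ≠ 0 := by
    intro x h
    obtain ⟨E, F, hx⟩ := s'.vol.exists_vol_ne_zero x
    exact hx (by rw [← hv, h, zero_mul])
  have hs : ContMDiff (𝓡 2) 𝓘(ℝ, ℝ) ∞ r := s.vol.contMDiff_of_mul_vol fun E F ↦ ⟨_, hv E F⟩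
  refine ⟨hΥ.linear, ⟨r, hs⟩, ⟨fun x ↦ (r x)⁻¹, fun x ↦ (hs x).inv₀ (h0 x)⟩,
    fun _ ↦ rfl, ?_, ?_, ?_⟩
  · ext x; exact mul_inv_cancel₀ (h0 x)
  · intro U V
    ext x
    exact hD (fun y ↦ V y) x (V.mdiffAt x) (U x)
  · intro U V
    exact ContMDiffMap.ext fun x ↦ (hv U V x).symm

end Scale

end

end ProjSurface

end

theorem theorem1 {M : Type*} [TopologicalSpace M] [T2Space M]
    [ChartedSpace (EuclideanSpace ℝ (Fin 2)) M] [IsManifold (𝓡 2) ∞ M]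
    (p : ProjSurface.ProjectiveStructure M) (s : ProjSurface.Scale p)
    (hρ : ∀ x : M, s.rho x ≠ 0) :
    -- the degrees of the three polynomials
    (∀ x : M, (s.P₁ x).natDegree = 6 ∧ (s.P₂ x).natDegree = 8 ∧ (s.P₃ x).natDegree = 6) ∧
    -- the coefficients are projective invariants: under a change of scale within the projective
    -- structure they are rescaled by a power of the ratio of the volume forms
    (∀ (s' : ProjSurface.Scale p) (r : M → ℝ),
      (∀ x : M, s'.vol.form x = r x • s.vol.form x) →
        ∀ (x : M) (k : ℕ),
          r x ^ 6 * (s'.P₁ x).coeff k = r x ^ k * (s.P₁ x).coeff k ∧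
          r x ^ 8 * (s'.P₂ x).coeff k = r x ^ k * (s.P₂ x).coeff k ∧
          r x ^ 6 * (s'.P₃ x).coeff k = r x ^ k * (s.P₃ x).coeff k) ∧
    -- the polynomial constraints
    (∀ α : ProjSurface.OneForm M, α.IsSmooth → ProjSurface.IsPEWSolution s.conn α →
      ∀ x : M,
        (s.P₁ x).eval (s.F α x) = 0 ∧
        (s.P₂ x).eval (s.F α x) = 0 ∧
        (s.P₃ x).eval (s.F α x) = 0) := by
  have hu := s.isUnit_rho hρ
  refine ⟨fun x ↦ ⟨?_, ?_, ?_⟩, fun s' r hr x k ↦ ?_, fun α hα hPEW x ↦ ?_⟩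
  · rw [ProjSurface.Scale.P₁]; compute_degree!
  · rw [ProjSurface.Scale.P₂]; compute_degree!
  · rw [ProjSurface.Scale.P₃]; compute_degree!
  · obtain ⟨Υ, f, g, hf, hc⟩ := ProjSurface.Scale.exists_isChange hr
    have hfx : ProjSurface.evalAt x f = r x := hf x
    have hr0 : r x ≠ 0 := hfx ▸ hc.χ_r_ne_zero (ProjSurface.evalAt x)
    have hρ' := hc.χ_ρ hu (ProjSurface.evalAt x)
    have h1 := hc.coeff_one hu (ProjSurface.evalAt x)
    have h2 := hc.coeff_two hu (ProjSurface.evalAt x)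
    have h3 := hc.coeff_three hu (ProjSurface.evalAt x)
    rw [← s'.rho_apply, ← s.rho_apply, hfx] at hρ'
    have h0 : s'.rho x ≠ 0 := by rw [hρ']; exact div_ne_zero (hρ x) (pow_ne_zero 5 hr0)
    obtain ⟨⟨a₁, a₂, a₃⟩, ⟨b₁, b₂, b₃⟩, ⟨c₁, c₂, c₃⟩⟩ := s.polynomials_eq (hρ x)
    obtain ⟨⟨a₁', a₂', a₃'⟩, ⟨b₁', b₂', b₃'⟩, ⟨c₁', c₂', c₃'⟩⟩ := s'.polynomials_eq h0
    rw [hfx, ← a₁, ← a₂, ← a₃, ← a₁', ← a₂', ← a₃'] at h1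
    rw [hfx, ← b₁, ← b₂, ← b₃, ← b₁', ← b₂', ← b₃'] at h2
    rw [hfx, ← c₁, ← c₂, ← c₃, ← c₁', ← c₂', ← c₃'] at h3
    have hρ'' : r x ^ 5 * s'.rho x = s.rho x := by rw [hρ']; field_simp
    simp only [ProjSurface.Scale.P₁, ProjSurface.Scale.P₂, ProjSurface.Scale.P₃,
      Polynomial.coeff_add, Polynomial.coeff_sub,
      Polynomial.coeff_C_mul, Polynomial.coeff_X_pow, Polynomial.coeff_X, Polynomial.coeff_C]
    rcases le_or_gt k 8 with hk | hk
    · interval_cases k <;> norm_num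
      · exact ⟨h1.2.2, h2.2.2, h3.2.2⟩
      · constructor
        · linear_combination 9 * r x * hρ''
        · linear_combination r x * hρ''
      · exact ⟨by linear_combination r x ^ 2 * h1.2.1, by linear_combination r x ^ 2 * h2.2.1,
          by linear_combination r x ^ 2 * h3.2.1⟩
      · linear_combination 20 * r x ^ 3 * hρ''
      · exact ⟨by linear_combination r x ^ 4 * h1.1, by linear_combination r x ^ 4 * h2.1,
          by linear_combination r x ^ 4 * h3.1⟩
    · have e : ∀ m < 9, k ≠ m := fun m hm ↦ by omega
      simp [e, (e 1 (by norm_num)).symm]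
  · have h := s.isEinsteinWeyl hα hPEW
    have hF : s.F α x = ProjSurface.evalAt x (s.Ffn hα) := rfl
    obtain ⟨⟨a₁, a₂, a₃⟩, ⟨b₁, b₂, b₃⟩, ⟨c₁, c₂, c₃⟩⟩ := s.polynomials_eq (hρ x)
    refine ⟨?_, ?_, ?_⟩
    · simp only [ProjSurface.Scale.P₁, Polynomial.eval_add, Polynomial.eval_sub,
        Polynomial.eval_mul, Polynomial.eval_pow, Polynomial.eval_C, Polynomial.eval_X]
      rw [a₁, a₂, a₃, hF, s.rho_apply]
      exact ProjSurface.SurfaceCalculus.polynomial_one h hu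
    · simp only [ProjSurface.Scale.P₂, Polynomial.eval_add, Polynomial.eval_mul,
        Polynomial.eval_pow, Polynomial.eval_C, Polynomial.eval_X]
      rw [b₁, b₂, b₃, hF, s.rho_apply]
      exact ProjSurface.SurfaceCalculus.polynomial_two h hu
    · simp only [ProjSurface.Scale.P₃, Polynomial.eval_add, Polynomial.eval_mul,
        Polynomial.eval_pow, Polynomial.eval_C, Polynomial.eval_X]
      rw [c₁, c₂, c₃, hF, s.rho_apply]
      exact ProjSurface.SurfaceCalculus.polynomial_three h hu
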